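/- Let $\mu,n,r,s,d$ be positive integers with $r\le n$, $n-r\le d\le n-1$ and $n-r\le \mu(n-r)-s$, and put $b=d+1-(n-r)$ and $\ell=b^n$. Then there are a prime power $q\ge bn$ and an integer $M\ge 1$ with $$q^M\;\le\; 2n\,\bigl(d+1-(n-r)\bigr)\,(2n\mu)^{s(r+1)-1},$$ distinct elements $\beta_{i,j}\in\mathbb F_q$ ($1\le i\le n$, $0\le j\le b-1$), and elements $\alpha_{i,j}\in\mathbb F_{q^M}$ ($1\le i\le \mu$, $1\le j\le n$), such that the following array code $\mathcal C$ over $\mathbb F_{q^M}$ with subpacketization $\ell=(d+1-(n-r))^n$ is a locally $d$-MSR $\mathsf{PMDS}(\mu n,\mu,n,r,s;\ell)$ array code: $$\mathcal C=\Bigl\{\mathbf C\in\mathbb F_{q^M}^{\ell\times \mu n}\;:\; \mathbf H^{(a)}\mathbf c^{(a)}=\mathbf 0\ \text{ for every row } \mathbf c^{(a)} \text{ of } \mathbf C,\ a=0,\dots,\ell-1\Bigr\},$$ $$\mathbf H^{(a)}=\begin{pmatrix}\mathbf H_0^{(a)}&&\\&\ddots&\\&&\mathbf H_0^{(a)}\\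 \mathbf H_1&\cdots&\mathbf H_\mu\end{pmatrix},\qquad \mathbf H_0^{(a)}=\bigl(\beta_{i,a_i}^{\,k}\bigr)_{0\le k\le r-1,\;1\le i\le n},\qquad \mathbf H_j=\bigl(\alpha_{j,i}^{\,q^k}\bigr)_{0\le k\le s-1,\;1\le i\le n},$$ where $a=\sum_{i=1}^n a_i b^{i-1}$ with $0\le a_i\le b-1$. Definitions. Let $\mathbb F$ be a finite field. An $[N,k,\delta;\ell]$ array code is an $\mathbb F$-linear subspace of $\mathbb F^{\ell\times N}$ of $\mathbb F$-dimension $k\ell$ in which the minimum number of nonzero columns of a nonzero element is $\delta$; it is MDS if $\delta=N-k+1$. $\mathcal C|_R$ denotes the restriction to the columns (nodes) in $R$. A $\mathsf{PMDS}(\mu n,\mu,n,r,s;\ell)$ code is an array code of length $\mu n$ and dimension $\mu(n-r)-s$ for which there is a partition $W_1,\dots,W_\mu$ of the $\mu n$ nodes into sets of size $n$ such that every $\mathcal C|_{W_i}$ is an $[n,n-r,r+1;\ell]$ MDS code and, for all $E_i\subseteq W_i$ with $|E_i|=r$, the restriction of $\mathcal C$ to the nodes outside $\bigcup_i E_i$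 is a $[\mu n-r\mu,\mu n-r\mu-s,s+1;\ell]$ MDS code. It is locally $d$-MSR if, for such a partition, every local code $\mathcal D=\mathcal C|_{W_i}$ is $d$-MSR, i.e. the maximum of $M(\mathcal D,\mathcal F,\mathcal R)$ over disjoint sets of nodes $\mathcal F,\mathcal R\subseteq W_i$ with $|\mathcal F|=1$, $|\mathcal R|=d$ equals $\dfrac{d\,\ell}{1+d-n+r}$; here $M(\mathcal D,\mathcal F,\mathcal R)$ is the smallest total number of symbols of $\mathbb F$ that the nodes in $\mathcal R$ have to send, each as a function of its own column, so that the columns in $\mathcal F$ are determined for every codeword of $\mathcal D$. -/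

import Mathlib

/-! ### Array codes

A word with `ℓ` symbols per node is a matrix with rows indexed by `Fin ℓ` and columns (nodes)
indexed by `ι`. An array code over the field `K` with subpacketization `ℓ` is a `K`-linear space
of such words. -/

/-- An array code over `K` with subpacketization `ℓ` and nodes indexed by `ι`. -/
abbrev ArrayCode (K : Type*) [Field K] (ℓ : ℕ) (ι : Type*) : Type _ :=
  Submodule K (Matrix (Fin ℓ) ι K)

namespace ArrayCode

/-- The weight of a word: its number of nonzero columns. -/
noncomputable def weight {K : Type*} [Field K] {ℓ : ℕ} {ι : Type*}
    (c : Matrix (Fin ℓ) ι K) : ℕ :=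
  Set.ncard {i : ι | ∃ a, c a i ≠ 0}

/-- The restriction `C|_R` of an array code to the nodes in `R`. -/
def restrict {K : Type*} [Field K] {ℓ : ℕ} {ι : Type*} (C : ArrayCode K ℓ ι) (R : Finset ι) :
    ArrayCode K ℓ R :=
  Submodule.map
    ({ toFun := fun c => c.submatrix id (fun i : R => (i : ι))
       map_add' := fun _ _ => rfl
       map_smul' := fun _ _ => rfl } : Matrix (Fin ℓ) ι K →ₗ[K] Matrix (Fin ℓ) R K) C

/-- The array code has dimension `k`, i.e. `k * ℓ` symbols of information. -/
def HasDim {K : Type*} [Field K] {ℓ : ℕ} {ι : Type*} (C : ArrayCode K ℓ ι) (k : ℕ) : Prop :=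
  Module.finrank K C = k * ℓ

/-- The minimum distance of the array code is `δ`. -/
def HasMinDist {K : Type*} [Field K] {ℓ : ℕ} {ι : Type*} (C : ArrayCode K ℓ ι) (δ : ℕ) : Prop :=
  IsLeast {w : ℕ | ∃ c ∈ C, c ≠ 0 ∧ weight c = w} δ

/-- The array code is an `[N, k, δ; ℓ]` MDS code. -/
structure IsMDS {K : Type*} [Field K] {ℓ : ℕ} {ι : Type*} [Fintype ι] (C : ArrayCode K ℓ ι)
    (N k δ : ℕ) : Prop where
  length : Fintype.card ι = N
  dim : C.HasDim k
  dist : C.HasMinDist δ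
  singleton : k + δ = N + 1

/-- Helper `j` in `R` sends the `m j` symbols `g j (c_j)`, a function of its own column; together
these determine the columns in `𝓕` of every codeword `c`. -/
def IsRepair {K : Type*} [Field K] {ℓ : ℕ} {ι : Type*} (C : ArrayCode K ℓ ι) (𝓕 R : Finset ι)
    (m : ι → ℕ) (g : (j : ι) → (Fin ℓ → K) → (Fin (m j) → K)) : Prop :=
  ∀ c ∈ C, ∀ c' ∈ C, (∀ j ∈ R, g j (fun a => c a j) = g j (fun a => c' a j)) →
    ∀ i ∈ 𝓕, ∀ a, c a i = c' a i

/-- The smallest number of symbols of `K` that have to be downloaded from the nodes in `R` to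
recover the nodes in `𝓕`. -/
noncomputable def repairBandwidth {K : Type*} [Field K] {ℓ : ℕ} {ι : Type*}
    (C : ArrayCode K ℓ ι) (𝓕 R : Finset ι) : ℕ :=
  sInf {B : ℕ | ∃ (m : ι → ℕ) (g : (j : ι) → (Fin ℓ → K) → (Fin (m j) → K)),
    C.IsRepair 𝓕 R m g ∧ ∑ j ∈ R, m j = B}

/-- The array code is an `[n, n - r; ℓ]` MDS code that is `(h, d)`-MSR: the maximal bandwidth for
the repair of `h` nodes from `d` other nodes meets the cut-set bound. -/
structure IsMSR {K : Type*} [Field K] {ℓ : ℕ} {ι : Type*} [Fintype ι] (C : ArrayCode K ℓ ι)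
    (n r h d : ℕ) : Prop where
  mds : C.IsMDS n (n - r) (r + 1)
  one_le_h : 1 ≤ h
  h_le : h ≤ r
  le_d : n - r ≤ d
  bandwidth : IsGreatest
    {x : ℚ | ∃ 𝓕 R : Finset ι, 𝓕.card = h ∧ R.card = d ∧ Disjoint 𝓕 R ∧
      x = C.repairBandwidth 𝓕 R}
    (((h : ℚ) * d * ℓ) / ((h : ℚ) + d - n + r))

/-- The array code is a `PMDS(μn, μ, n, r, s; ℓ)` code with local groups `W 0, …, W (μ - 1)`. -/
structure IsPMDSWith {K : Type*} [Field K] {ℓ : ℕ} {ι : Type*} [Fintype ι] [DecidableEq ι]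
    (C : ArrayCode K ℓ ι) (μ n r s : ℕ) (W : Fin μ → Finset ι) : Prop where
  pos : 0 < μ ∧ 0 < n ∧ 0 < r ∧ 0 < s ∧ 0 < ℓ
  r_le : r ≤ n
  s_le : s ≤ (n - r) * μ
  length : Fintype.card ι = μ * n
  dim : C.HasDim ((n - r) * μ - s)
  disjoint : Pairwise (fun i j => Disjoint (W i) (W j))
  cover : Finset.univ.biUnion W = Finset.univ
  card_group : ∀ i, (W i).card = n
  localMDS : ∀ i, (C.restrict (W i)).IsMDS n (n - r) (r + 1)
  globalMDS : ∀ E : Fin μ → Finset ι, (∀ i, E i ⊆ W i ∧ (E i).card = r) →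
    (C.restrict (Finset.univ \ Finset.univ.biUnion E)).IsMDS
      (μ * n - r * μ) (μ * n - r * μ - s) (s + 1)

/-- The array code is a locally `(h, d)`-MSR `PMDS(μn, μ, n, r, s; ℓ)` code: for some partition
into local groups it is PMDS and each of its local codes is `(h, d)`-MSR. -/
def IsLocallyMSRPMDS {K : Type*} [Field K] {ι : Type*} [Fintype ι] [DecidableEq ι]
    (μ n r s h d ℓ : ℕ) (C : ArrayCode K ℓ ι) : Prop :=
  ∃ W : Fin μ → Finset ι, C.IsPMDSWith μ n r s W ∧ ∀ i, (C.restrict (W i)).IsMSR n r h d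

end ArrayCode

/-! ### The construction

Nodes are pairs (group, position in the group) in `Fin μ × Fin n`. Rows are indexed by
`a : Fin (b ^ n)`, with base-`b` digits `a = ∑ i, a_i * b ^ i`. -/

/-- The `i`-th digit of `a` in base `b`, least significant digit first. -/
def baseDigit {b n : ℕ} (a : Fin (b ^ n)) (i : Fin n) : Fin b :=
  finFunctionFinEquiv.symm a i

/-- The parity-check matrix `H^(a)`. Its first `r * μ` rows are block diagonal, with the `r × n`
Vandermonde matrix of `β_{1,a_1}, …, β_{n,a_n}` in each block; its last `s` rows are
`α_{j,i} ^ (q ^ k)` for `k = 0, …, s - 1`. -/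
def pmdsParityCheck {F K : Type*} [Field F] [Field K] [Algebra F K] {μ n b : ℕ} (r s q : ℕ)
    (β : Fin n → Fin b → F) (α : Fin μ → Fin n → K) (a : Fin (b ^ n)) :
    Matrix ((Fin μ × Fin r) ⊕ Fin s) (Fin μ × Fin n) K :=
  Matrix.of fun row col =>
    match row with
    | Sum.inl (j, k) =>
        if j = col.1 then algebraMap F K (β col.2 (baseDigit a col.2)) ^ (k : ℕ) else 0
    | Sum.inr k => α col.1 col.2 ^ (q ^ (k : ℕ))

/-- The array code of all arrays whose `a`-th row is in the kernel of `H^(a)`, for every `a`. -/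
def pmdsCode {F K : Type*} [Field F] [Field K] [Algebra F K] {μ n b : ℕ} (r s q : ℕ)
    (β : Fin n → Fin b → F) (α : Fin μ → Fin n → K) :
    ArrayCode K (b ^ n) (Fin μ × Fin n) where
  carrier := {C | ∀ a, (pmdsParityCheck r s q β α a).mulVec (C a) = 0}
  add_mem' := by
    intro C D hC hD a
    have h : (C + D) a = C a + D a := rfl
    rw [h, Matrix.mulVec_add, hC a, hD a, add_zero]
  zero_mem' := fun a => Matrix.mulVec_zero _
  smul_mem' := by
    intro x C hC a
    have h : (x • C) a = x • C a := rfl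
    rw [h, Matrix.mulVec_smul, hC a, smul_zero]

/-!
A code as required is obtained from *admissible* families (`Admissible`): nodes `β` in a finite
field `F` and vectors `A x` over `F`, one for each of the `N = μ * n` nodes `x`, such that no
nonzero vector `v` over `F` that satisfies the local checks and lives on `r` nodes per group
together with `s` more nodes satisfies `∑ x, v x • A x = 0`. The proof has three parts.

**Admissible families yield the code.** The vectors `A x` are read as elements of the extension
field `K`. The global checks are the rows of a Moore matrix, so a Moore determinant
(`eq_zero_of_sum_mul_pow_card_pow`) reduces the independence of columns of the parity-check matrix
over `K` to a statement over `F`, which is admissibility (`eq_zero_of_admissible`). Every row of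
the array code therefore has the right dimension and distances, and so has their product. By a
dimension count the restriction to a group is the full code of its local checks
(`isLocalCode_restrict`). A failed node of such a local code is repaired as in the construction of
Ye and Barg: each helper sends the sums of its symbols over the rows that differ only in the digit
of the failed node (`exists_isRepair`). The cut-set bound, averaged over all sets of `b` helpers,
shows that no scheme needs less (`le_sum_of_isRepair`, `repairBandwidth_eq`).

**Three constructions of families.** With `b = d + 1 - (n - r)`:

* For `b ≤ μ` the powers `X x ^ 1, …, X x ^ (s * (r + 1) - 1)` of distinct elements of `F` work
  (`hasScheme_of_le`): an active group meets the `s` further nodes, so at most `s * (r + 1)`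
  nodes are active, and the local checks supply the exponent `0`.
* The vectors can be chosen greedily (`exists_coeffs_of_family`). All vectors to be separated
  lie in spaces of dimension at most `s`, one for each set of active nodes and each choice of
  digits on this set; the number of these spaces through a node bounds the size of `K`
  (`hasScheme_of_choose_mul_le`).
* For `s ≤ μ` a first tier of `s` coordinates reduces the number of spaces. By the pigeonhole
  principle the nodes `β i t` can be taken in fibres of one polynomial of degree `r`
  (`exists_fibre_nodes`); its value `γ i` on the fibre then acts as an additional local check.
  The coordinates `z j ^ u * γ i`, for `u < s`, enforce this check in all groups, which kills
  the groups with only one of the `s` further nodes. The remaining vectors involve at most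
  `s / 2` groups and are separated by a greedy second tier (`admissible_append`).

**Size of the field.** For `μ < b` and `s > μ` the greedy choice is good enough
(`hasScheme_of_lt`). For `2 ≤ s ≤ μ < b ≤ r` it is so if `n` is small in comparison with `r`
(`OneTierBound`), and the choice in two tiers is so if `n` is large (`TwoTierBound`). The two
ranges cover all `n`: they meet at `r ^ 2` for `r ≤ 18`, and at `r ^ 4` for `r ≥ 19`. For `s = 1`
the first tier is enough.
-/

/-! ### Vandermonde and Moore systems -/

/-- A linear form that kills the powers `x ^ k`, `k < m`, of the nodes kills every polynomial of
degree less than `m` in the nodes. -/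
theorem sum_mul_eval_eq_zero {L ι : Type*} [Field L] {I : Finset ι} {x v : ι → L} {m : ℕ}
    (h : ∀ k < m, ∑ i ∈ I, v i * x i ^ k = 0) (p : Polynomial L) (hp : p.natDegree < m) :
    ∑ i ∈ I, v i * p.eval (x i) = 0 := by
  have h1 : ∀ i ∈ I, v i * p.eval (x i)
      = ∑ k ∈ Finset.range m, p.coeff k * (v i * x i ^ k) := by
    intro i _
    rw [Polynomial.eval_eq_sum_range' hp, Finset.mul_sum]
    exact Finset.sum_congr rfl fun k _ => by ring
  rw [Finset.sum_congr rfl h1, Finset.sum_comm]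
  refine Finset.sum_eq_zero fun k hk => ?_
  rw [← Finset.mul_sum, h k (Finset.mem_range.1 hk), mul_zero]

theorem eq_zero_of_sum_mul_pow_eq_zero {L ι : Type*} [Field L] {I : Finset ι} {x v : ι → L} {m : ℕ}
    (hx : Set.InjOn x I) (hI : I.card ≤ m) (h : ∀ k < m, ∑ i ∈ I, v i * x i ^ k = 0) :
    ∀ i ∈ I, v i = 0 := by
  classical
  intro i hi
  have hdeg : (∏ j ∈ I.erase i, (Polynomial.X - Polynomial.C (x j))).natDegree < m := by
    rw [Polynomial.natDegree_prod_of_monic _ _ fun j _ => Polynomial.monic_X_sub_C _]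
    simp only [Polynomial.natDegree_X_sub_C, Finset.sum_const, smul_eq_mul, mul_one]
    exact lt_of_lt_of_le (Finset.card_erase_lt_of_mem hi) hI
  have h1 := sum_mul_eval_eq_zero h _ hdeg
  rw [Finset.sum_eq_single i] at h1
  · refine (mul_eq_zero.1 h1).resolve_right ?_
    rw [Polynomial.eval_prod]
    refine Finset.prod_ne_zero_iff.2 fun j hj => ?_
    rw [Polynomial.eval_sub, Polynomial.eval_X, Polynomial.eval_C, sub_ne_zero]
    exact fun hij => (Finset.ne_of_mem_erase hj) (hx (Finset.mem_of_mem_erase hj) hi hij.symm)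
  · intro j hj hji
    rw [Polynomial.eval_prod, Finset.prod_eq_zero (Finset.mem_erase.2 ⟨hji, hj⟩), mul_zero]
    simp
  · exact fun h => absurd hi h

/-- A vector supported on at most `m` distinct nodes is zero if it is orthogonal to the first `m`
powers of the nodes. -/
theorem eq_zero_of_support_subset {L ι : Type*} [Field L] [Fintype ι] {I : Finset ι} {x v : ι → L}
    {m : ℕ} (hx : Set.InjOn x I) (hI : I.card ≤ m) (hv : ∀ i, v i ≠ 0 → i ∈ I)
    (h : ∀ k < m, ∑ i, v i * x i ^ k = 0) : v = 0 := by
  have h0 : ∀ i ∈ I, v i = 0 := by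
    refine eq_zero_of_sum_mul_pow_eq_zero hx hI fun k hk => ?_
    rw [← h k hk]
    refine Finset.sum_subset (Finset.subset_univ _) fun i _ hi => ?_
    rw [not_imp_comm.1 (hv i) hi, zero_mul]
  funext i
  by_contra hi
  exact hi (h0 i (hv i hi))

/-- The Lagrange coefficients that express the powers of one node by those of `r` others. -/
theorem exists_lagrange_coeff {L ι : Type*} [Field L] [DecidableEq ι] {I : Finset ι} {x : ι → L}
    (hx : Set.InjOn x I) (y : L) :
    ∃ w : ι → L, ∀ k < I.card, ∑ i ∈ I, w i * x i ^ k = y ^ k := by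
  refine ⟨fun i => (Lagrange.basis I x i).eval y, fun k hk => ?_⟩
  have h := Lagrange.eq_interpolate (s := I) (v := x) (f := Polynomial.X ^ k) hx
    (by rw [Polynomial.degree_X_pow]; exact_mod_cast hk)
  have h2 := congrArg (Polynomial.eval y) h
  rw [Lagrange.interpolate_apply, Polynomial.eval_finsetSum, Polynomial.eval_pow,
    Polynomial.eval_X] at h2
  rw [h2]
  refine Finset.sum_congr rfl fun i _ => ?_
  simp [mul_comm]

/-- A subspace of `ι → L` whose elements are determined by their values on `A` has dimension at
most `#A`. -/
theorem finrank_le_card_of_vanish {L ι : Type*} [Field L] [Fintype ι] (V : Submodule L (ι → L))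
    (A : Finset ι) (h : ∀ v ∈ V, (∀ i ∈ A, v i = 0) → v = 0) : Module.finrank L V ≤ A.card := by
  have hinj : Function.Injective
      ((LinearMap.funLeft L L (fun i : A => (i : ι))).comp V.subtype) := by
    rw [← LinearMap.ker_eq_bot, LinearMap.ker_eq_bot']
    intro v hv
    refine Subtype.ext (h v v.2 fun i hi => ?_)
    exact congrFun hv ⟨i, hi⟩
  have := LinearMap.finrank_le_finrank_of_injective hinj
  simpa using this

theorem frobeniusAlgHom_pow_apply {F K : Type*} [Field F] [Fintype F] [Field K] [Algebra F K]
    (k : ℕ) (y : K) :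
    ((FiniteField.frobeniusAlgHom F K) ^ k) y = y ^ (Fintype.card F ^ k) := by
  rw [AlgHom.coe_pow, FiniteField.coe_frobeniusAlgHom, pow_iterate]

theorem sum_smul_pow_card_pow {F K ι : Type*} [Field F] [Fintype F] [Field K] [Algebra F K]
    (I : Finset ι) (v : ι → F) (α : ι → K) (k : ℕ) :
    (∑ i ∈ I, v i • α i) ^ (Fintype.card F ^ k)
      = ∑ i ∈ I, v i • α i ^ (Fintype.card F ^ k) := by
  simp only [← frobeniusAlgHom_pow_apply (F := F), map_sum, map_smul]

/-- The Moore matrix of linearly independent elements is invertible: a nonzero linearized polynomial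
of `q`-degree less than `#S` cannot vanish on the span of `#S` independent elements. -/
theorem eq_zero_of_sum_mul_pow_card_pow {F K S : Type*} [Field F] [Fintype F] [Field K]
    [Algebra F K] [Fintype S] {θ : S → K} (hθ : LinearIndependent F θ) {s : ℕ} (hs : Fintype.card S ≤ s)
    {c : S → K} (h : ∀ k < s, ∑ i, c i * θ i ^ (Fintype.card F ^ k) = 0) : c = 0 := by
  classical
  set q := Fintype.card F
  have hq : 1 < q := Fintype.one_lt_card
  set e := Fintype.equivFin S
  let Mo : Matrix S S K := Matrix.of fun k i => θ i ^ (q ^ (e k : ℕ))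
  have hdet : Mo.det ≠ 0 := by
    intro h0
    obtain ⟨d, hd, hd0⟩ := Matrix.exists_vecMul_eq_zero_iff.2 h0
    apply hd
    let P : Polynomial K := ∑ k, Polynomial.C (d k) * Polynomial.X ^ (q ^ (e k : ℕ))
    have hP : ∀ k, P.coeff (q ^ (e k : ℕ)) = d k := by
      intro k
      simp only [P, Polynomial.finsetSum_coeff, Polynomial.coeff_C_mul, Polynomial.coeff_X_pow]
      rw [Finset.sum_eq_single k]
      · simp
      · intro l _ hl
        rw [if_neg, mul_zero]
        intro hkl
        exact hl (e.injective (Fin.ext (Nat.pow_right_injective hq hkl))).symm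
      · simp
    have hP0 : P = 0 := by
      refine Polynomial.eq_zero_of_natDegree_lt_card_of_eval_eq_zero P
        (f := fun x : S → F => ∑ i, x i • θ i) ?_ ?_ ?_
      · intro x y hxy
        have h1 : ∑ i, (x i - y i) • θ i = 0 := by
          simp only [sub_smul, Finset.sum_sub_distrib]
          exact sub_eq_zero.2 hxy
        funext i
        exact sub_eq_zero.1 (Fintype.linearIndependent_iff.1 hθ _ h1 i)
      · intro x
        simp only [P, Polynomial.eval_finsetSum, Polynomial.eval_mul, Polynomial.eval_C,
          Polynomial.eval_pow, Polynomial.eval_X]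
        have h1 : ∀ k, d k * (∑ i, x i • θ i) ^ q ^ (e k : ℕ)
            = ∑ i, x i • (d k * θ i ^ q ^ (e k : ℕ)) := by
          intro k
          rw [sum_smul_pow_card_pow, Finset.mul_sum]
          exact Finset.sum_congr rfl fun i _ => by rw [mul_smul_comm]
        simp only [h1]
        rw [Finset.sum_comm]
        refine Finset.sum_eq_zero fun i _ => ?_
        rw [← Finset.smul_sum]
        have h2 := congrFun hd0 i
        simp only [Matrix.vecMul, dotProduct, Mo, Matrix.of_apply, Pi.zero_apply] at h2
        rw [h2, smul_zero]
      · rw [Fintype.card_fun]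
        rcases isEmpty_or_nonempty S with hS | hS
        · simp [P]
        · refine lt_of_le_of_lt (Polynomial.natDegree_sum_le_of_forall_le _ _
            (n := q ^ (Fintype.card S - 1)) fun k _ => ?_) ?_
          · refine (Polynomial.natDegree_C_mul_X_pow_le _ _).trans ?_
            exact Nat.pow_le_pow_right (by omega) (by have := (e k).2; omega)
          · exact Nat.pow_lt_pow_right hq (by have := Fintype.card_pos (α := S); omega)
    funext k
    rw [← hP k, hP0, Polynomial.coeff_zero]
    rfl
  by_contra hc
  refine hdet (Matrix.exists_mulVec_eq_zero_iff.1 ⟨c, hc, ?_⟩)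
  funext k
  simp only [Matrix.mulVec, dotProduct, Mo, Matrix.of_apply, Pi.zero_apply]
  rw [← h (e k) (lt_of_lt_of_le (e k).2 hs)]
  exact Finset.sum_congr rfl fun i _ => mul_comm _ _

/-! ### Array codes that are products of row codes -/

namespace ArrayCode

/-- The dimension of an array code whose rows range independently over the row codes `D a`. -/
theorem finrank_of_rows {K ι : Type*} [Field K] [Fintype ι] {ℓ : ℕ} {C : ArrayCode K ℓ ι}
    {D : Fin ℓ → Submodule K (ι → K)} (hC : ∀ c, c ∈ C ↔ ∀ a, c a ∈ D a) :
    Module.finrank K C = ∑ a, Module.finrank K (D a) := by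
  let e : C ≃ₗ[K] ((a : Fin ℓ) → D a) :=
    { toFun := fun c a => ⟨c.1 a, (hC c.1).1 c.2 a⟩
      invFun := fun f => ⟨fun a => (f a : ι → K), (hC _).2 fun a => (f a).2⟩
      map_add' := fun _ _ => rfl
      map_smul' := fun _ _ => rfl
      left_inv := fun _ => rfl
      right_inv := fun _ => rfl }
  rw [LinearEquiv.finrank_eq e, Module.finrank_pi_fintype]

/-- A product of MDS row codes of dimension `k` is an MDS array code. -/
theorem isMDS_of_rows {K ι : Type*} [Field K] [Fintype ι] {ℓ : ℕ} {C : ArrayCode K ℓ ι}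
    {D : Fin ℓ → Submodule K (ι → K)} (hC : ∀ c, c ∈ C ↔ ∀ a, c a ∈ D a) {N k δ : ℕ}
    (hN : Fintype.card ι = N) (hk : 1 ≤ k) (hkδ : k + δ = N + 1) (hℓ : 0 < ℓ)
    (hδ : 1 ≤ δ)
    (hdim : ∀ a, Module.finrank K (D a) = k)
    (hlow : ∀ a, ∀ v ∈ D a, ∀ T : Finset ι, T.card < δ → (∀ x, v x ≠ 0 → x ∈ T) → v = 0) :
    C.IsMDS N k δ := by
  classical
  have hlb : ∀ c ∈ C, c ≠ 0 → δ ≤ weight c := by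
    intro c hc hc0
    by_contra hlt
    apply hc0
    funext a
    refine hlow a (c a) ((hC c).1 hc a) (Finset.univ.filter fun i => ∃ a, c a i ≠ 0) ?_ ?_
    · rw [weight, Set.ncard_eq_toFinset_card'] at hlt
      simpa [Set.toFinset_ofPred] using hlt
    · intro x hx
      simpa using ⟨a, hx⟩
  refine ⟨hN, ?_, ⟨?_, ?_⟩, hkδ⟩
  · rw [HasDim, finrank_of_rows hC]
    simp [hdim, mul_comm]
  · -- a nonzero word in one row that vanishes on `k - 1` prescribed nodes
    obtain ⟨A, -, hA⟩ := Finset.exists_subset_card_eq (s := (Finset.univ : Finset ι)) (n := k - 1)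
      (by rw [Finset.card_univ, hN]; omega)
    let a : Fin ℓ := ⟨0, hℓ⟩
    have : ∃ v ∈ D a, (∀ i ∈ A, v i = 0) ∧ v ≠ 0 := by
      by_contra hcon
      have hle := finrank_le_card_of_vanish (D a) A
        fun v hv h => by_contra fun h0 => hcon ⟨v, hv, h, h0⟩
      rw [hdim, hA] at hle
      omega
    obtain ⟨v, hv, hvA, hv0⟩ := this
    let c : Matrix (Fin ℓ) ι K := fun a' => if a' = a then v else 0
    have hc : c ∈ C := by
      refine (hC c).2 fun a' => ?_
      by_cases h : a' = a
      · subst h; simpa [c] using hv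
      · simp [c, h]
    have hc0 : c ≠ 0 := by
      intro h0
      apply hv0
      exact (if_pos rfl).symm.trans (congrFun h0 a)
    refine ⟨c, hc, hc0, le_antisymm ?_ (hlb c hc hc0)⟩
    have hsub : {i : ι | ∃ a, c a i ≠ 0} ⊆ ((Finset.univ \ A : Finset ι) : Set ι) := by
      rintro i ⟨a', ha'⟩
      simp only [Finset.coe_sdiff, Finset.coe_univ, Set.mem_sdiff, Set.mem_univ, true_and]
      intro hi
      apply ha'
      by_cases h : a' = a
      · simp [c, h, hvA i hi]
      · simp [c, h]
    have := Set.ncard_le_ncard hsub (Finset.finite_toSet _)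
    rw [Set.ncard_coe_finset, Finset.card_sdiff_of_subset (Finset.subset_univ _), hA,
      Finset.card_univ, hN] at this
    rw [weight]
    omega
  · rintro w ⟨c, hc, hc0, rfl⟩
    exact hlb c hc hc0

end ArrayCode

/-! ### Words killed by the parity-check matrix -/

/-- The parity checks of a local group that see the row with digits `dg`: the row vector `v` of the
group is orthogonal to the first `r` powers of the nodes `β i (dg i)`. -/
def LocalCheck {L : Type*} [Field L] {n b : ℕ} (r : ℕ) (β : Fin n → Fin b → L) (dg : Fin n → Fin b)
    (v : Fin n → L) : Prop :=
  ∀ k < r, ∑ i, v i * β i (dg i) ^ k = 0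

/-- The family `α` is admissible if it separates the erasure patterns of a PMDS code: whenever a
nonzero vector over the base field satisfies all local checks and lives on `r` nodes per group
together with `s` further nodes, its combination of the `α` does not vanish. -/
def Admissible {F V : Type*} [Field F] [AddCommGroup V] [Module F V] {μ n b : ℕ} (r s : ℕ)
    (β : Fin n → Fin b → F) (α : Fin μ × Fin n → V) : Prop :=
  ∀ (dg : Fin n → Fin b) (v : Fin μ × Fin n → F) (E : Fin μ → Finset (Fin n))
    (S : Finset (Fin μ × Fin n)),
    (∀ j, LocalCheck r β dg fun i => v (j, i)) → (∀ j, (E j).card = r) → S.card = s →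
    (∀ x ∈ S, x.2 ∉ E x.1) → (∀ x, v x ≠ 0 → x.2 ∈ E x.1 ∨ x ∈ S) →
    ∑ x, v x • α x = 0 → v = 0

theorem injective_of_uncurry {F : Type*} {n b : ℕ} {β : Fin n → Fin b → F}
    (hβ : Function.Injective (Function.uncurry β)) (dg : Fin n → Fin b) :
    Function.Injective fun i => β i (dg i) := by
  intro i i' h
  have := @hβ (i, dg i) (i', dg i') h
  exact congrArg Prod.fst this

/-- Local checks see every vector supported on `r` nodes. -/
theorem LocalCheck.eq_zero {L : Type*} [Field L] {n b r : ℕ} {β : Fin n → Fin b → L}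
    (hβ : Function.Injective (Function.uncurry β)) {dg : Fin n → Fin b} {v : Fin n → L}
    (hv : LocalCheck r β dg v) {I : Finset (Fin n)} (hI : I.card ≤ r)
    (hvI : ∀ i, v i ≠ 0 → i ∈ I) : v = 0 :=
  eq_zero_of_support_subset (injective_of_uncurry hβ dg).injOn hI hvI hv

theorem pmdsParityCheck_mulVec_eq_zero_iff {F K : Type*} [Field F] [Field K] [Algebra F K]
    {μ n b : ℕ} {r s q : ℕ} {β : Fin n → Fin b → F} {α : Fin μ → Fin n → K} {a : Fin (b ^ n)}
    {c : Fin μ × Fin n → K} :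
    (pmdsParityCheck r s q β α a).mulVec c = 0 ↔
      (∀ j, LocalCheck r (fun i t => algebraMap F K (β i t)) (baseDigit a) fun i => c (j, i)) ∧
        ∀ k < s, ∑ x, c x * (α x.1 x.2) ^ (q ^ k) = 0 := by
  have h1 : ∀ (j : Fin μ) (k : Fin r), (pmdsParityCheck r s q β α a).mulVec c (Sum.inl (j, k))
      = ∑ i, c (j, i) * algebraMap F K (β i (baseDigit a i)) ^ (k : ℕ) := by
    intro j k
    simp only [Matrix.mulVec, dotProduct, pmdsParityCheck, Matrix.of_apply]
    rw [Fintype.sum_prod_type, Finset.sum_eq_single j]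
    · exact Finset.sum_congr rfl fun i _ => by rw [if_pos rfl, mul_comm]
    · intro j' _ hj'
      exact Finset.sum_eq_zero fun i _ => by rw [if_neg (Ne.symm hj'), zero_mul]
    · exact fun h => absurd (Finset.mem_univ j) h
  have h2 : ∀ k : Fin s, (pmdsParityCheck r s q β α a).mulVec c (Sum.inr k)
      = ∑ x, c x * (α x.1 x.2) ^ (q ^ (k : ℕ)) := by
    intro k
    simp only [Matrix.mulVec, dotProduct, pmdsParityCheck, Matrix.of_apply]
    exact Finset.sum_congr rfl fun x _ => mul_comm _ _
  constructor
  · intro h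
    refine ⟨fun j k hk => ?_, fun k hk => ?_⟩
    · have := congrFun h (Sum.inl (j, ⟨k, hk⟩))
      rw [h1] at this
      exact this
    · have := congrFun h (Sum.inr ⟨k, hk⟩)
      rw [h2] at this
      exact this
  · rintro ⟨hl, hg⟩
    funext row
    rcases row with ⟨j, k⟩ | k
    · rw [h1]; exact hl j k k.2
    · rw [h2]; exact hg k k.2

/-- A vector over the base field that satisfies the local checks, takes the value `1` at one node
`x` and is otherwise supported on `r` nodes of the group of `x`. -/
theorem exists_localCheck_vector {F : Type*} [Field F] {μ n b r : ℕ} {β : Fin n → Fin b → F}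
    (hβ : Function.Injective (Function.uncurry β)) (dg : Fin n → Fin b)
    {E : Fin μ → Finset (Fin n)} (hE : ∀ j, (E j).card = r) {x : Fin μ × Fin n}
    (hx : x.2 ∉ E x.1) :
    ∃ v : Fin μ × Fin n → F, (∀ j, LocalCheck r β dg fun i => v (j, i)) ∧ v x = 1 ∧
      ∀ y, v y ≠ 0 → y.2 ∈ E y.1 ∨ y = x := by
  classical
  obtain ⟨w, hw⟩ := exists_lagrange_coeff (I := E x.1) (injective_of_uncurry hβ dg).injOn
    (β x.2 (dg x.2))
  rw [hE] at hw
  refine ⟨fun y => if y.1 = x.1 then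
    (if y.2 = x.2 then 1 else 0) - (if y.2 ∈ E x.1 then w y.2 else 0) else 0, ?_, ?_, ?_⟩
  · intro j k hk
    by_cases hj : j = x.1
    · simp only [hj, if_true, sub_mul, Finset.sum_sub_distrib, ite_mul, one_mul, zero_mul,
        Finset.sum_ite_eq', Finset.mem_univ]
      rw [Finset.sum_ite_mem, Finset.univ_inter, hw k hk, sub_self]
    · simp [hj]
  · simp [hx]
  · intro y hy
    by_contra hcon
    push Not at hcon
    apply hy
    by_cases h1 : y.1 = x.1
    · have h2 : y.2 ≠ x.2 := fun h2 => hcon.2 (Prod.ext h1 h2)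
      have h3 : y.2 ∉ E x.1 := h1 ▸ hcon.1
      simp [h1, h2, h3]
    · simp [h1]

/-- The union of the erased nodes `E j` of all groups. -/
def groupUnion {μ n : ℕ} (E : Fin μ → Finset (Fin n)) : Finset (Fin μ × Fin n) :=
  Finset.univ.filter fun x => x.2 ∈ E x.1

@[simp] theorem mem_groupUnion {μ n : ℕ} {E : Fin μ → Finset (Fin n)} {x : Fin μ × Fin n} :
    x ∈ groupUnion E ↔ x.2 ∈ E x.1 := by simp [groupUnion]

theorem card_groupUnion {μ n : ℕ} (E : Fin μ → Finset (Fin n)) :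
    (groupUnion E).card = ∑ j, (E j).card := by
  classical
  rw [groupUnion, Finset.card_filter, Fintype.sum_prod_type]
  exact Finset.sum_congr rfl fun j _ => by simp

/-- Admissibility makes the columns of the parity-check matrix at `r` nodes per group and `s` more
nodes linearly independent over the large field. -/
theorem eq_zero_of_admissible {F K : Type*} [Field F] [Fintype F] [Field K] [Algebra F K]
    {μ n b r s : ℕ} {β : Fin n → Fin b → F} {α : Fin μ → Fin n → K}
    (hβ : Function.Injective (Function.uncurry β))
    (hα : Admissible r s β fun x : Fin μ × Fin n => α x.1 x.2)
    (hs : s + r * μ ≤ μ * n) {a : Fin (b ^ n)} {c : Fin μ × Fin n → K}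
    (hc : (pmdsParityCheck r s (Fintype.card F) β α a).mulVec c = 0)
    {E : Fin μ → Finset (Fin n)} (hE : ∀ j, (E j).card = r) {S : Finset (Fin μ × Fin n)}
    (hS : S.card ≤ s) (hcES : ∀ x, c x ≠ 0 → x.2 ∈ E x.1 ∨ x ∈ S) : c = 0 := by
  classical
  obtain ⟨hl, hg⟩ := pmdsParityCheck_mulVec_eq_zero_iff.1 hc
  have hβK : Function.Injective (Function.uncurry fun i t => algebraMap F K (β i t)) := fun x y h =>
    hβ ((algebraMap F K).injective h)
  -- replace `S` by a set of exactly `s` nodes outside the `E j`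
  have hcard : (groupUnion E).card = μ * r := by
    rw [card_groupUnion]; simp [hE]
  obtain ⟨S', hSS', hS'E, hS'⟩ : ∃ S', S \ groupUnion E ⊆ S' ∧ S' ⊆ Finset.univ \ groupUnion E ∧
      S'.card = s := by
    refine Finset.exists_subsuperset_card_eq (Finset.sdiff_subset_sdiff (Finset.subset_univ _)
      (Finset.Subset.refl _)) ((Finset.card_le_card Finset.sdiff_subset).trans hS) ?_
    rw [Finset.card_sdiff_of_subset (Finset.subset_univ _), hcard, Finset.card_univ]
    simp only [Fintype.card_prod, Fintype.card_fin]
    rw [mul_comm] at hs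
    have := mul_comm r μ
    have := mul_comm n μ
    omega
  have hS'n : ∀ x ∈ S', x.2 ∉ E x.1 := fun x hx => by
    have := hS'E hx
    simpa using this
  have hcES' : ∀ x, c x ≠ 0 → x.2 ∈ E x.1 ∨ x ∈ S' := by
    intro x hx
    by_cases h : x.2 ∈ E x.1
    · exact Or.inl h
    · refine Or.inr (hSS' ?_)
      simpa [h] using (hcES x hx)
  have hv : ∀ x : S', ∃ v : Fin μ × Fin n → F,
      (∀ j, LocalCheck r β (baseDigit a) fun i => v (j, i)) ∧ v x = 1 ∧
      ∀ y, v y ≠ 0 → y.2 ∈ E y.1 ∨ y = x := fun x =>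
    exists_localCheck_vector hβ (baseDigit a) hE (hS'n x x.2)
  choose v hvl hv1 hvs using hv
  have hv0 : ∀ x y : S', x ≠ y → v x y = 0 := by
    intro x y hxy
    by_contra h
    rcases hvs x y h with h | h
    · exact hS'n y y.2 h
    · exact hxy (Subtype.ext h).symm
  -- `c` is the combination of the base field vectors `v x` with coefficients `c x`
  have hdec : ∀ y, c y = ∑ x : S', c x * algebraMap F K (v x y) := by
    have hz : ∀ j, (fun i => c (j, i) - ∑ x : S', c x * algebraMap F K (v x (j, i))) = 0 := by
      intro j
      refine LocalCheck.eq_zero (r := r) hβK (dg := baseDigit a) (I := E j) ?_ (hE j).le ?_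
      · intro k hk
        simp only [sub_mul, Finset.sum_sub_distrib, hl j k hk, zero_sub, neg_eq_zero,
          Finset.sum_mul]
        rw [Finset.sum_comm]
        refine Finset.sum_eq_zero fun x _ => ?_
        have := congrArg (algebraMap F K) (hvl x j k hk)
        simp only [map_sum, map_mul, map_pow, map_zero] at this
        simp only [mul_assoc]
        rw [← Finset.mul_sum, this, mul_zero]
      · intro i hi
        by_contra hiE
        apply hi
        by_cases hiS : (j, i) ∈ S'
        · rw [Finset.sum_eq_single (⟨(j, i), hiS⟩ : S')]
          · rw [hv1 ⟨(j, i), hiS⟩, map_one, mul_one, sub_self]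
          · intro x _ hx
            rw [hv0 x ⟨(j, i), hiS⟩ hx, map_zero, mul_zero]
          · exact fun h => absurd (Finset.mem_univ _) h
        · have h1 : c (j, i) = 0 := by
            by_contra h
            exact (hcES' _ h).elim hiE hiS
          rw [h1, zero_sub, neg_eq_zero]
          refine Finset.sum_eq_zero fun x _ => ?_
          have h2 : v x (j, i) = 0 := by
            by_contra h
            rcases hvs x _ h with h | h
            · exact hiE h
            · exact hiS (h ▸ x.2)
          rw [h2, map_zero, mul_zero]
    rintro ⟨j, i⟩
    exact sub_eq_zero.1 (congrFun (hz j) i)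
  let θ : S' → K := fun x => ∑ y, v x y • α y.1 y.2
  have hθ : LinearIndependent F θ := by
    rw [Fintype.linearIndependent_iff]
    intro g hg0
    have h0 : (fun y => ∑ x, g x * v x y) = 0 := by
      refine hα (baseDigit a) _ E S' ?_ hE hS' hS'n ?_ ?_
      · intro j k hk
        simp only [Finset.sum_mul]
        rw [Finset.sum_comm]
        refine Finset.sum_eq_zero fun x _ => ?_
        simp only [mul_assoc]
        rw [← Finset.mul_sum]
        have := hvl x j k hk
        rw [this, mul_zero]
      · intro y hy
        by_contra hcon
        push Not at hcon
        apply hy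
        refine Finset.sum_eq_zero fun x _ => ?_
        have : v x y = 0 := by
          by_contra h
          rcases hvs x y h with h | h
          · exact hcon.1 h
          · exact hcon.2 (h ▸ x.2)
        rw [this, mul_zero]
      · rw [← hg0]
        simp only [θ, Finset.smul_sum, Finset.sum_smul, mul_smul]
        rw [Finset.sum_comm]
    intro x
    have := congrFun h0 x
    rw [Finset.sum_eq_single x] at this
    · simpa [hv1] using this
    · intro y _ hy
      rw [hv0 y x hy, mul_zero]
    · exact fun h => absurd (Finset.mem_univ _) h
  have hcS : (fun x : S' => c x) = 0 := by
    refine eq_zero_of_sum_mul_pow_card_pow hθ (s := s) (by simp [hS']) fun k hk => ?_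
    rw [← hg k hk]
    have h1 : ∀ y : Fin μ × Fin n, c y * α y.1 y.2 ^ Fintype.card F ^ k
        = ∑ x : S', c x * (v x y • α y.1 y.2 ^ Fintype.card F ^ k) := by
      intro y
      rw [hdec y, Finset.sum_mul]
      exact Finset.sum_congr rfl fun x _ => by rw [Algebra.smul_def, mul_assoc]
    simp only [h1]
    rw [Finset.sum_comm]
    refine Finset.sum_congr rfl fun x _ => ?_
    rw [← Finset.mul_sum, sum_smul_pow_card_pow]
  funext y
  rw [hdec y]
  refine Finset.sum_eq_zero fun x _ => ?_
  rw [show c x = 0 from congrFun hcS x, zero_mul]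

/-! ### The local codes: MDS property and repair -/

/-- The row code cut out by the first `r` powers of the nodes `x`. -/
def vandermondeCode {L ι : Type*} [Field L] [Fintype ι] (r : ℕ) (x : ι → L) :
    Submodule L (ι → L) where
  carrier := {v | ∀ k < r, ∑ i, v i * x i ^ k = 0}
  add_mem' := by
    intro v w hv hw k hk
    simp only [Pi.add_apply, add_mul, Finset.sum_add_distrib, hv k hk, hw k hk, add_zero]
  zero_mem' := by
    intro k _
    simp
  smul_mem' := by
    intro y v hv k hk
    simp only [Pi.smul_apply, smul_eq_mul, mul_assoc]
    rw [← Finset.mul_sum, hv k hk, mul_zero]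

theorem card_sub_le_finrank_ker {L ι κ : Type*} [Field L] [Fintype ι] [Fintype κ]
    (f : (ι → L) →ₗ[L] (κ → L)) :
    Fintype.card ι ≤ Module.finrank L (LinearMap.ker f) + Fintype.card κ := by
  have h1 := LinearMap.finrank_range_add_finrank_ker f
  have h2 := Submodule.finrank_le (LinearMap.range f)
  simp only [Module.finrank_fintype_fun_eq_card] at h1 h2
  omega

theorem finrank_vandermondeCode {L ι : Type*} [Field L] [Fintype ι] {r : ℕ} {x : ι → L}
    (hx : Function.Injective x) (hr : r ≤ Fintype.card ι) :
    Module.finrank L (vandermondeCode r x) = Fintype.card ι - r := by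
  classical
  apply le_antisymm
  · obtain ⟨I, -, hI⟩ := Finset.exists_subset_card_eq (s := (Finset.univ : Finset ι)) (n := r)
      (by rwa [Finset.card_univ])
    have := finrank_le_card_of_vanish (vandermondeCode r x) (Finset.univ \ I) fun v hv h =>
      eq_zero_of_support_subset (I := I) hx.injOn hI.le
        (fun i hi => by
          by_contra hiI
          exact hi (h i (by simpa using hiI))) hv
    rwa [Finset.card_sdiff_of_subset (Finset.subset_univ _), hI, Finset.card_univ] at this
  · let f : (ι → L) →ₗ[L] (Fin r → L) :=
      { toFun := fun v k => ∑ i, v i * x i ^ (k : ℕ)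
        map_add' := fun v w => by
          funext k
          simp [add_mul, Finset.sum_add_distrib]
        map_smul' := fun y v => by
          funext k
          simp [mul_assoc, Finset.mul_sum] }
    have hf : LinearMap.ker f = vandermondeCode r x := by
      ext v
      rw [LinearMap.mem_ker]
      constructor
      · intro h k hk
        exact congrFun h ⟨k, hk⟩
      · intro h
        funext k
        exact h k k.2
    have := card_sub_le_finrank_ker f
    rw [hf, Fintype.card_fin] at this
    omega

/-- If every `b`-subset of `R` has `m`-weight at least `B`, then `R` has weight at least
`#R * B / b`. -/
theorem card_mul_le_of_forall_powersetCard {ι : Type*} [DecidableEq ι] (R : Finset ι) (m : ι → ℕ)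
    {b B : ℕ} (hb : 1 ≤ b) (hbR : b ≤ R.card) (h : ∀ Y ⊆ R, Y.card = b → B ≤ ∑ j ∈ Y, m j) :
    R.card * B ≤ b * ∑ j ∈ R, m j := by
  have h1 : (R.card.choose b) * B ≤ ∑ Y ∈ R.powersetCard b, ∑ j ∈ Y, m j := by
    rw [← Finset.card_powersetCard, ← smul_eq_mul]
    refine Finset.card_nsmul_le_sum _ _ _ fun Y hY => ?_
    rw [Finset.mem_powersetCard] at hY
    exact h Y hY.1 hY.2
  have h2 : ∑ Y ∈ R.powersetCard b, ∑ j ∈ Y, m j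
      = ((R.card - 1).choose (b - 1)) * ∑ j ∈ R, m j := by
    have h3 : ∀ Y ∈ R.powersetCard b, ∑ j ∈ Y, m j = ∑ j ∈ R, if j ∈ Y then m j else 0 := by
      intro Y hY
      rw [Finset.sum_ite_mem, Finset.inter_eq_right.2 (Finset.mem_powersetCard.1 hY).1]
    rw [Finset.sum_congr rfl h3, Finset.sum_comm, Finset.mul_sum]
    refine Finset.sum_congr rfl fun j hj => ?_
    rw [← Finset.sum_filter, Finset.sum_const, smul_eq_mul]
    congr 1
    have h4 := Finset.card_filter_powersetCard_subset {j} R b (by simpa using hj)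
      (by simpa using hb)
    simpa only [Finset.singleton_subset_iff, Finset.card_singleton] using h4
  have h5 : R.card * ((R.card - 1).choose (b - 1)) = R.card.choose b * b := by
    have := Nat.add_one_mul_choose_eq (R.card - 1) (b - 1)
    rwa [Nat.sub_add_cancel (by omega), Nat.sub_add_cancel hb] at this
  have hpos : 0 < (R.card - 1).choose (b - 1) := Nat.choose_pos (by omega)
  refine Nat.le_of_mul_le_mul_left ?_ hpos
  calc (R.card - 1).choose (b - 1) * (R.card * B)
      = b * (R.card.choose b * B) := by rw [← mul_assoc, mul_comm _ R.card, h5]; ring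
    _ ≤ b * (((R.card - 1).choose (b - 1)) * ∑ j ∈ R, m j) := by
        rw [← h2]; exact Nat.mul_le_mul_left _ h1
    _ = _ := by ring

namespace ArrayCode

/-- The local code of the construction, on an arbitrary set of nodes in bijection with `Fin n`:
all arrays whose `a`-th row satisfies the checks of the nodes `β i (a_i)`. -/
def IsLocalCode {K ι : Type*} [Field K] [Fintype ι] {n b : ℕ} (r : ℕ) (β : Fin n → Fin b → K)
    (e : ι ≃ Fin n) (D : ArrayCode K (b ^ n) ι) : Prop :=
  ∀ c, c ∈ D ↔ ∀ a, c a ∈ vandermondeCode r fun i => β (e i) (baseDigit a (e i))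

theorem injective_nodes {K ι : Type*} {n b : ℕ} {β : Fin n → Fin b → K}
    (hβ : Function.Injective (Function.uncurry β)) (e : ι ≃ Fin n)
    (dg : Fin n → Fin b) : Function.Injective fun i => β (e i) (dg (e i)) :=
  (injective_of_uncurry hβ dg).comp e.injective

variable {K ι : Type*} [Field K] [Fintype ι] {n b r : ℕ} {β : Fin n → Fin b → K}
  {e : ι ≃ Fin n} {D : ArrayCode K (b ^ n) ι}

theorem IsLocalCode.isMDS (hD : IsLocalCode r β e D) (hβ : Function.Injective (Function.uncurry β))
    (hrn : r < n) (hb : 0 < b) : D.IsMDS n (n - r) (r + 1) := by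
  have hn : Fintype.card ι = n := by rw [Fintype.card_congr e, Fintype.card_fin]
  refine isMDS_of_rows hD hn (by omega) (by omega) (pow_pos hb n) (by omega) (fun a => ?_)
    (fun a v hv T hT hvT => ?_)
  · rw [finrank_vandermondeCode (injective_nodes hβ e _) (by omega), hn]
  · exact eq_zero_of_support_subset (injective_nodes hβ e _).injOn (by omega) hvT hv

/-- The cut-set bound: together with `n - r - 1` nodes whose content is known, any other `b` helpers
have to transmit at least `ℓ` symbols, because the failed column is then still arbitrary. -/
theorem IsLocalCode.le_sum_of_isRepair [Fintype K] [DecidableEq ι] (hD : IsLocalCode r β e D)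
    (hβ : Function.Injective (Function.uncurry β)) (hrn : r < n) {i : ι} {R Y : Finset ι}
    (hiR : i ∉ R) (hYR : Y ⊆ R) (hY : R.card + r + 1 = n + Y.card)
    {m : ι → ℕ} {g : (j : ι) → (Fin (b ^ n) → K) → (Fin (m j) → K)}
    (hg : D.IsRepair {i} R m g) : b ^ n ≤ ∑ j ∈ Y, m j := by
  have hn : Fintype.card ι = n := by rw [Fintype.card_congr e, Fintype.card_fin]
  have hext : ∀ z : Fin (b ^ n) → K, ∃ c ∈ D, (∀ j ∈ R \ Y, ∀ a, c a j = 0) ∧ ∀ a, c a i = z a := by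
    intro z
    have hrow : ∀ a, ∃ v ∈ vandermondeCode r fun i => β (e i) (baseDigit a (e i)),
        (∀ j ∈ R \ Y, v j = 0) ∧ v i = z a := by
      intro a
      set V := vandermondeCode r fun i => β (e i) (baseDigit a (e i))
      let A : Finset ι := insert i (R \ Y)
      have hA : A.card + r = n := by
        rw [Finset.card_insert_of_notMem (fun h => hiR (Finset.mem_sdiff.1 h).1),
          Finset.card_sdiff_of_subset hYR]
        have := Finset.card_le_card hYR
        omega
      let f : V →ₗ[K] (A → K) := (LinearMap.funLeft K K (fun y : A => (y : ι))).comp V.subtype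
      have hinj : Function.Injective f := by
        rw [← LinearMap.ker_eq_bot, LinearMap.ker_eq_bot']
        intro v hv
        refine Subtype.ext ?_
        refine eq_zero_of_support_subset (I := Finset.univ \ A) (injective_nodes hβ e _).injOn
          (m := r) ?_ (fun y hy => ?_) v.2
        · rw [Finset.card_sdiff_of_subset (Finset.subset_univ _), Finset.card_univ]
          omega
        · simp only [Finset.mem_sdiff, Finset.mem_univ, true_and]
          exact fun hyA => hy (congrFun hv ⟨y, hyA⟩)
      have hsurj : Function.Surjective f := by
        refine (LinearMap.injective_iff_surjective_of_finrank_eq_finrank ?_).1 hinj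
        rw [finrank_vandermondeCode (injective_nodes hβ e _) (by omega),
          Module.finrank_fintype_fun_eq_card, Fintype.card_coe]
        omega
      obtain ⟨v, hv⟩ := hsurj fun y => if (y : ι) = i then z a else 0
      refine ⟨v, v.2, fun j hj => ?_, ?_⟩
      · have := congrFun hv ⟨j, Finset.mem_insert_of_mem hj⟩
        have hji : j ≠ i := fun h => hiR (h ▸ (Finset.mem_sdiff.1 hj).1)
        simpa [f, LinearMap.funLeft, hji] using this
      · have := congrFun hv ⟨i, Finset.mem_insert_self _ _⟩
        simpa [f, LinearMap.funLeft] using this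
    choose v hv hv0 hvz using hrow
    exact ⟨fun a => v a, (hD _).2 hv, fun j hj a => hv0 a j hj, hvz⟩
  choose c hcD hc0 hcz using hext
  have hinj : Function.Injective fun (z : Fin (b ^ n) → K) (j : Y) => g j fun a => c z a j := by
    intro z z' hzz'
    have h := hg (c z) (hcD z) (c z') (hcD z') ?_ i (Finset.mem_singleton_self i)
    · funext a
      rw [← hcz z a, ← hcz z' a, h a]
    · intro j hj
      by_cases hjY : j ∈ Y
      · exact congrFun hzz' ⟨j, hjY⟩
      · have hj' : j ∈ R \ Y := Finset.mem_sdiff.2 ⟨hj, hjY⟩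
        have h1 : (fun a => c z a j) = fun a => c z' a j := by
          funext a
          rw [hc0 z j hj' a, hc0 z' j hj' a]
        rw [h1]
  have hcard := Fintype.card_le_of_injective _ hinj
  rw [Fintype.card_fun, Fintype.card_pi, Fintype.card_fin] at hcard
  simp only [Fintype.card_fun, Fintype.card_fin] at hcard
  rw [Finset.prod_pow_eq_pow_sum, Finset.sum_coe_sort Y m] at hcard
  exact (Nat.pow_le_pow_iff_right Fintype.one_lt_card).1 hcard

/-- The function that agrees with `w` off `i` and takes the value `t` at `i`. -/
def fillAt {n b : ℕ} (i : Fin n) (w : {i' : Fin n // i' ≠ i} → Fin b) (t : Fin b) : Fin n → Fin b :=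
  fun i' => if h : i' = i then t else w ⟨i', h⟩

/-- Helper `j` transmits, for all digits `w` off the failed position, the sum of its symbols in the
`b` rows with digits `w`. Summing the checks of these rows leaves a Vandermonde system of `r`
equations in `r` unknowns: the `b` symbols of the failed node and the sums of the `n - 1 - d`
remaining nodes. -/
theorem IsLocalCode.exists_isRepair [DecidableEq ι] (hD : IsLocalCode r β e D)
    (hβ : Function.Injective (Function.uncurry β)) {i : ι} {R : Finset ι}
    (hiR : i ∉ R) (hR : n + b ≤ R.card + 1 + r) :
    ∃ g : (j : ι) → (Fin (b ^ n) → K) → (Fin (b ^ (n - 1)) → K),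
      D.IsRepair {i} R (fun _ => b ^ (n - 1)) g := by
  classical
  have hn : Fintype.card ι = n := by rw [Fintype.card_congr e, Fintype.card_fin]
  have hcard : Fintype.card ({i' : Fin n // i' ≠ e i} → Fin b) = b ^ (n - 1) := by
    simp [Fintype.card_subtype_compl]
  let eq := (Fintype.equivFinOfCardEq hcard).symm
  let row : ({i' : Fin n // i' ≠ e i} → Fin b) → Fin b → Fin (b ^ n) := fun w t =>
    finFunctionFinEquiv (fillAt (e i) w t)
  have hrow : ∀ w t, baseDigit (row w t) = fillAt (e i) w t := by
    intro w t
    funext i'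
    simp [baseDigit, row]
  refine ⟨fun j x k => ∑ t, x (row (eq k) t), ?_⟩
  -- by linearity it suffices to consider a word all of whose messages vanish
  have key : ∀ c ∈ D, (∀ j ∈ R, ∀ w, ∑ t, c (row w t) j = 0) → ∀ a, c a i = 0 := by
    intro c hc hmsg a
    let w : {i' : Fin n // i' ≠ e i} → Fin b := fun i' => baseDigit a i'
    -- unknowns: `Sum.inl j` for a node `j ≠ i`, `Sum.inr t` for the failed node in row `row w t`
    let x : ι ⊕ Fin b → K := Sum.elim
      (fun j => if h : e j = e i then 0 else β (e j) (w ⟨e j, h⟩)) (fun t => β (e i) t)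
    let v : ι ⊕ Fin b → K := Sum.elim
      (fun j => if j = i then 0 else ∑ t, c (row w t) j) (fun t => c (row w t) i)
    let I : Finset (ι ⊕ Fin b) := (Finset.univ \ insert i R).disjSum Finset.univ
    have hI : I.card ≤ r := by
      have h1 := Finset.card_le_univ (insert i R)
      have h2 := Finset.card_insert_of_notMem hiR
      rw [Finset.card_disjSum, Finset.card_sdiff_of_subset (Finset.subset_univ _),
        Finset.card_univ, Finset.card_univ, Fintype.card_fin]
      omega
    have hxI : Set.InjOn x I := by
      have hne : ∀ j : ι, Sum.inl j ∈ I → e j ≠ e i := by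
        intro j hj
        have : j ≠ i := by
          rintro rfl
          simp [I] at hj
        exact fun h => this (e.injective h)
      rintro (j | t) hj (j' | t') hj' hjj'
      · have h1 := hne j hj
        have h2 := hne j' hj'
        simp only [x, Sum.elim_inl, h1, h2, dif_neg, not_false_eq_true] at hjj'
        have := @hβ (e j, _) (e j', _) hjj'
        rw [e.injective (congrArg Prod.fst this)]
      · have h1 := hne j hj
        simp only [x, Sum.elim_inl, Sum.elim_inr, h1, dif_neg, not_false_eq_true] at hjj'
        have := @hβ (e j, _) (e i, _) hjj'
        exact absurd (congrArg Prod.fst this) h1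
      · have h2 := hne j' hj'
        simp only [x, Sum.elim_inl, Sum.elim_inr, h2, dif_neg, not_false_eq_true] at hjj'
        have := @hβ (e i, _) (e j', _) hjj'
        exact absurd (congrArg Prod.fst this).symm h2
      · simp only [x, Sum.elim_inr] at hjj'
        have := @hβ (e i, _) (e i, _) hjj'
        exact congrArg (fun z => Sum.inr z.2) this
    have hv0 : v = 0 := by
      refine eq_zero_of_support_subset hxI hI ?_ ?_
      · rintro (j | t) hj
        · simp only [I, Finset.inl_mem_disjSum, Finset.mem_sdiff, Finset.mem_univ, true_and,
            Finset.mem_insert, not_or]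
          simp only [v, Sum.elim_inl] at hj
          refine ⟨fun h => hj (by simp [h]), fun h => hj ?_⟩
          rw [hmsg j h w]
          simp
        · simp [I]
      · intro k hk
        have hsum : ∑ t, ∑ j, c (row w t) j * β (e j) (baseDigit (row w t) (e j)) ^ k = 0 :=
          Finset.sum_eq_zero fun t _ => (hD c).1 hc (row w t) k hk
        rw [Fintype.sum_sum_type, ← hsum, Finset.sum_comm, ← Finset.add_sum_erase _ _
          (Finset.mem_univ i), ← Finset.add_sum_erase (a := i) Finset.univ (fun j => ∑ t, _)
          (Finset.mem_univ i)]
        simp only [hrow]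
        have h1 : ∀ j ∈ Finset.univ.erase i, v (Sum.inl j) * x (Sum.inl j) ^ k
            = ∑ t, c (row w t) j * β (e j) (fillAt (e i) w t (e j)) ^ k := by
          intro j hj
          have hji : j ≠ i := Finset.ne_of_mem_erase hj
          have hej : e j ≠ e i := fun h => hji (e.injective h)
          simp [v, x, hji, hej, fillAt, Finset.sum_mul]
        rw [Finset.sum_congr rfl h1]
        simp only [v, x, Sum.elim_inl, Sum.elim_inr, if_true, zero_mul, zero_add, fillAt, dif_pos]
        rw [add_comm]
    have ha : row w (baseDigit a (e i)) = a := by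
      apply finFunctionFinEquiv.symm.injective
      funext i'
      change baseDigit (row w (baseDigit a (e i))) i' = baseDigit a i'
      rw [hrow]
      by_cases h : i' = e i
      · subst h; simp [fillAt]
      · simp [fillAt, h, w]
    have := congrFun hv0 (Sum.inr (baseDigit a (e i)))
    simpa [v, ha] using this
  intro c hc c' hc' hcc' i' hi' a
  rw [Finset.mem_singleton] at hi'
  subst hi'
  have h0 := key (c - c') (D.sub_mem hc hc') (fun j hj w => ?_) a
  · exact sub_eq_zero.1 h0
  · have := congrFun (hcc' j hj) (eq.symm w)
    simp only [eq.apply_symm_apply] at this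
    simp only [Matrix.sub_apply, Finset.sum_sub_distrib, this, sub_self]

/-- The repair scheme attains the cut-set bound, averaged over all sets of `b` helpers. -/
theorem IsLocalCode.repairBandwidth_eq [Fintype K] [DecidableEq ι] (hD : IsLocalCode r β e D)
    (hβ : Function.Injective (Function.uncurry β)) (hrn : r < n) (hb : 0 < b) {i : ι}
    {R : Finset ι} (hiR : i ∉ R) (hbR : b ≤ R.card) (hR : R.card + 1 + r = n + b) :
    D.repairBandwidth {i} R = R.card * b ^ (n - 1) := by
  obtain ⟨g, hg⟩ := hD.exists_isRepair hβ hiR hR.ge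
  apply le_antisymm
  · exact Nat.sInf_le ⟨_, g, hg, by simp⟩
  · refine le_csInf ⟨_, _, g, hg, rfl⟩ ?_
    rintro B ⟨m, g', hg', rfl⟩
    have h := card_mul_le_of_forall_powersetCard R m hb hbR fun Y hYR hY =>
      hD.le_sum_of_isRepair hβ hrn hiR hYR (by omega) hg'
    obtain ⟨n', rfl⟩ : ∃ n', n = n' + 1 := ⟨n - 1, by omega⟩
    rw [Nat.add_sub_cancel]
    refine Nat.le_of_mul_le_mul_left ?_ hb
    calc b * (R.card * b ^ n') = R.card * b ^ (n' + 1) := by rw [pow_succ]; ring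
      _ ≤ _ := h

theorem IsLocalCode.isMSR [Fintype K] [DecidableEq ι] {d : ℕ} (hD : IsLocalCode r β e D)
    (hβ : Function.Injective (Function.uncurry β)) (hr : 0 < r) (hrn : r < n) (hd : n - r ≤ d)
    (hdn : d < n) (hb : b = d + 1 - (n - r)) : D.IsMSR n r 1 d := by
  have hn : Fintype.card ι = n := by rw [Fintype.card_congr e, Fintype.card_fin]
  have hb0 : 0 < b := by omega
  have hval : ((1 : ℕ) : ℚ) * d * (b ^ n : ℕ) / (((1 : ℕ) : ℚ) + d - n + r)
      = ((d * b ^ (n - 1) : ℕ) : ℚ) := by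
    have hbq : (((1 : ℕ) : ℚ) + d - n + r) = b := by
      have : b + n = d + 1 + r := by omega
      have h2 : (b : ℚ) + n = d + 1 + r := by exact_mod_cast this
      push_cast
      linarith
    obtain ⟨n', rfl⟩ : ∃ n', n = n' + 1 := ⟨n - 1, by omega⟩
    have hbq0 : (b : ℚ) ≠ 0 := by exact_mod_cast hb0.ne'
    rw [hbq, Nat.add_sub_cancel, div_eq_iff hbq0]
    push_cast
    ring
  have hall : ∀ 𝓕 R : Finset ι, 𝓕.card = 1 → R.card = d → Disjoint 𝓕 R →
      D.repairBandwidth 𝓕 R = d * b ^ (n - 1) := by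
    intro 𝓕 R h𝓕 hRd hdis
    obtain ⟨i, rfl⟩ := Finset.card_eq_one.1 h𝓕
    rw [hD.repairBandwidth_eq hβ hrn hb0 (Finset.disjoint_singleton_left.1 hdis) (by omega)
      (by omega), hRd]
  refine ⟨hD.isMDS hβ hrn hb0, le_rfl, hr, hd, ?_⟩
  rw [hval]
  constructor
  · have hne : (Finset.univ : Finset ι).Nonempty := by
      rw [← Finset.card_pos, Finset.card_univ]; omega
    obtain ⟨i, -⟩ := hne
    obtain ⟨R, hRi, hRd⟩ := Finset.exists_subset_card_eq (s := Finset.univ.erase i) (n := d)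
      (by rw [Finset.card_erase_of_mem (Finset.mem_univ _), Finset.card_univ]; omega)
    have hdis : Disjoint {i} R := by
      rw [Finset.disjoint_singleton_left]
      exact fun h => Finset.notMem_erase _ _ (hRi h)
    exact ⟨{i}, R, by simp, hRd, hdis, by rw [hall _ _ (by simp) hRd hdis]⟩
  · rintro x ⟨𝓕, R, h𝓕, hRd, hdis, rfl⟩
    rw [hall 𝓕 R h𝓕 hRd hdis]

end ArrayCode

/-! ### From admissible families to PMDS codes with repairable groups -/

namespace ArrayCode

/-- The restriction of a product of row codes is the product of the restricted row codes. -/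
theorem mem_restrict_iff_rows {K ι : Type*} [Field K] {ℓ : ℕ} {C : ArrayCode K ℓ ι}
    {D : Fin ℓ → Submodule K (ι → K)} (hC : ∀ c, c ∈ C ↔ ∀ a, c a ∈ D a) (R : Finset ι)
    (c : Matrix (Fin ℓ) R K) :
    c ∈ C.restrict R ↔ ∀ a, c a ∈ (D a).map (LinearMap.funLeft K K (fun i : R => (i : ι))) := by
  constructor
  · rintro ⟨w, hw, rfl⟩ a
    exact ⟨w a, (hC w).1 hw a, rfl⟩
  · intro h
    choose w hw hwc using h
    exact ⟨fun a => w a, (hC _).2 hw, funext hwc⟩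

end ArrayCode

theorem finrank_map_of_forall_eq_zero {L V W : Type*} [Field L] [AddCommGroup V] [Module L V]
    [AddCommGroup W] [Module L W] (U : Submodule L V) (f : V →ₗ[L] W)
    (h : ∀ v ∈ U, f v = 0 → v = 0) : Module.finrank L (U.map f) = Module.finrank L U := by
  rw [← LinearMap.range_domRestrict]
  refine LinearMap.finrank_range_of_inj ?_
  rw [← LinearMap.ker_eq_bot, LinearMap.ker_eq_bot']
  exact fun v hv => Subtype.ext (h v v.2 hv)

/-- The nodes of group `j`. -/
def groupNodes (μ n : ℕ) (j : Fin μ) : Finset (Fin μ × Fin n) :=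
  Finset.univ.filter fun x => x.1 = j

@[simp] theorem mem_groupNodes {μ n : ℕ} {j : Fin μ} {x : Fin μ × Fin n} :
    x ∈ groupNodes μ n j ↔ x.1 = j := by simp [groupNodes]

/-- The nodes of a group are numbered by their position. -/
def groupNodesEquiv (μ n : ℕ) (j : Fin μ) : groupNodes μ n j ≃ Fin n where
  toFun x := x.1.2
  invFun i := ⟨(j, i), by simp⟩
  left_inv := by
    rintro ⟨⟨j', i⟩, h⟩
    obtain rfl : j' = j := by simpa using h
    rfl
  right_inv _ := rfl

theorem card_groupNodes (μ n : ℕ) (j : Fin μ) : (groupNodes μ n j).card = n := by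
  rw [← Fintype.card_coe, Fintype.card_congr (groupNodesEquiv μ n j), Fintype.card_fin]

section

variable {F K : Type*} [Field F] [Field K] [Algebra F K]
  {μ n b r s : ℕ} {β : Fin n → Fin b → F} {α : Fin μ → Fin n → K}

theorem mem_pmdsCode_iff_rows {q : ℕ} (c : Matrix (Fin (b ^ n)) (Fin μ × Fin n) K) :
    c ∈ pmdsCode r s q β α ↔
      ∀ a, c a ∈ LinearMap.ker (pmdsParityCheck r s q β α a).mulVecLin :=
  Iff.rfl

theorem le_finrank_row {q : ℕ} (a : Fin (b ^ n)) :
    μ * n ≤ Module.finrank K (LinearMap.ker (pmdsParityCheck r s q β α a).mulVecLin)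
      + (μ * r + s) := by
  simpa using card_sub_le_finrank_ker (pmdsParityCheck r s q β α a).mulVecLin

variable [Fintype F]

/-- The words of a row code that vanish on `B` are determined by their values outside `B`, the `E j`
and `S`. -/
theorem finrank_ker_inf_le (hβ : Function.Injective (Function.uncurry β))
    (hα : Admissible r s β fun x : Fin μ × Fin n => α x.1 x.2) (hs : s + r * μ ≤ μ * n)
    (a : Fin (b ^ n)) {E : Fin μ → Finset (Fin n)} (hE : ∀ j, (E j).card = r)
    {S : Finset (Fin μ × Fin n)} (hS : S.card ≤ s) (B : Finset (Fin μ × Fin n))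
    (U : Submodule K (Fin μ × Fin n → K))
    (hU : U ≤ LinearMap.ker (pmdsParityCheck r s (Fintype.card F) β α a).mulVecLin)
    (hUB : ∀ v ∈ U, ∀ x ∈ B, v x = 0) :
    Module.finrank K U ≤ (Finset.univ \ (B ∪ (groupUnion E ∪ S))).card := by
  refine finrank_le_card_of_vanish _ _ fun v hv h => ?_
  refine eq_zero_of_admissible hβ hα hs (hU hv) hE hS fun x hx => ?_
  by_contra hcon
  push Not at hcon
  by_cases hxB : x ∈ B
  · exact hx (hUB v hv x hxB)
  · exact hx (h x (by simp [hxB, hcon.1, hcon.2]))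

theorem finrank_row (hβ : Function.Injective (Function.uncurry β))
    (hα : Admissible r s β fun x : Fin μ × Fin n => α x.1 x.2) (hrn : r ≤ n)
    (hs : s ≤ (n - r) * μ) (a : Fin (b ^ n)) :
    Module.finrank K (LinearMap.ker (pmdsParityCheck r s (Fintype.card F) β α a).mulVecLin)
      = (n - r) * μ - s := by
  obtain ⟨I, -, hI⟩ := Finset.exists_subset_card_eq (s := (Finset.univ : Finset (Fin n))) (n := r)
    (by simpa using hrn)
  have hN : (n - r) * μ + μ * r = μ * n := by
    rw [mul_comm (n - r), ← mul_add, Nat.sub_add_cancel hrn]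
  let E : Fin μ → Finset (Fin n) := fun _ => I
  have hcard : (groupUnion E).card = μ * r := by
    rw [card_groupUnion]; simp [E, hI]
  have hcompl : (Finset.univ \ groupUnion E).card = (n - r) * μ := by
    rw [Finset.card_sdiff_of_subset (Finset.subset_univ _), hcard, Finset.card_univ]
    simp only [Fintype.card_prod, Fintype.card_fin]
    omega
  obtain ⟨S, hSE, hS⟩ := Finset.exists_subset_card_eq (hcompl ▸ hs)
  apply le_antisymm
  · refine (finrank_ker_inf_le hβ hα (by rw [mul_comm r]; omega) a (fun _ => hI) hS.le ∅ _ le_rfl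
      (by simp)).trans (le_of_eq ?_)
    rw [Finset.empty_union, ← Finset.sup_eq_union, ← sdiff_sdiff_left,
      Finset.card_sdiff_of_subset hSE, hcompl, hS]
  · have := le_finrank_row (K := K) (r := r) (s := s) (q := Fintype.card F) (β := β) (α := α) a
    omega

/-- A local code is the full code of its own parity checks: the global checks do not reduce its
dimension. -/
theorem isLocalCode_restrict (hβ : Function.Injective (Function.uncurry β))
    (hα : Admissible r s β fun x : Fin μ × Fin n => α x.1 x.2) (hrn : r ≤ n)
    (hs : (n - r) + s ≤ (n - r) * μ) (j : Fin μ) :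
    ((pmdsCode r s (Fintype.card F) β α).restrict (groupNodes μ n j)).IsLocalCode r
      (fun i t => algebraMap F K (β i t)) (groupNodesEquiv μ n j) := by
  classical
  intro c
  rw [ArrayCode.mem_restrict_iff_rows mem_pmdsCode_iff_rows]
  refine forall_congr' fun a => ?_
  set V := LinearMap.ker (pmdsParityCheck r s (Fintype.card F) β α a).mulVecLin with hV
  set f := LinearMap.funLeft K K (fun i : groupNodes μ n j => (i : Fin μ × Fin n)) with hf
  set D := vandermondeCode r fun i : groupNodes μ n j =>
    algebraMap F K (β (groupNodesEquiv μ n j i) (baseDigit a (groupNodesEquiv μ n j i))) with hD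
  have hβK : Function.Injective (Function.uncurry fun i t => algebraMap F K (β i t)) := fun x y h =>
    hβ ((algebraMap F K).injective h)
  have hle : V.map f ≤ D := by
    rintro _ ⟨v, hv, rfl⟩ k hk
    have h := (pmdsParityCheck_mulVec_eq_zero_iff.1 hv).1 j k hk
    rw [← h]
    refine Fintype.sum_equiv (groupNodesEquiv μ n j) _ _ ?_
    rintro ⟨⟨j', i⟩, hj'⟩
    obtain rfl : j' = j := by simpa using hj'
    rfl
  have hDdim : Module.finrank K D = n - r := by
    rw [hD, finrank_vandermondeCode (ArrayCode.injective_nodes hβK _ _)] <;>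
      rw [Fintype.card_coe, card_groupNodes]
    exact hrn
  have hdim : n - r ≤ Module.finrank K (V.map f) := by
    obtain ⟨I, -, hI⟩ := Finset.exists_subset_card_eq (s := (Finset.univ : Finset (Fin n)))
      (n := r) (by simpa using hrn)
    let E : Fin μ → Finset (Fin n) := fun _ => I
    have hμ : 1 ≤ μ := by have := j.2; omega
    have hcard : (groupNodes μ n j ∪ groupUnion E).card = n + (μ - 1) * r := by
      have h1 : groupNodes μ n j ∪ groupUnion E
          = groupUnion fun j' => if j' = j then Finset.univ else I := by
        ext x
        by_cases h : x.1 = j <;> simp [h, E]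
      rw [h1, card_groupUnion, ← Finset.add_sum_erase _ _ (Finset.mem_univ j),
        Finset.sum_congr rfl fun j' hj' => by rw [if_neg (Finset.ne_of_mem_erase hj')]]
      simp [hI]
    have hN : (n - r) * μ + μ * r = μ * n := by
      rw [mul_comm (n - r), ← mul_add, Nat.sub_add_cancel hrn]
    have hμr : (μ - 1) * r + r = μ * r := by
      rw [← Nat.succ_mul, Nat.succ_eq_add_one, Nat.sub_add_cancel hμ]
    have hcompl : (Finset.univ \ (groupNodes μ n j ∪ groupUnion E)).card + (n - r)
        = (n - r) * μ := by
      rw [Finset.card_sdiff_of_subset (Finset.subset_univ _), hcard, Finset.card_univ]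
      simp only [Fintype.card_prod, Fintype.card_fin]
      omega
    -- the other groups leave room for `S`, because `(n - r) + s ≤ (n - r) * μ`
    obtain ⟨S, hSE, hS⟩ := Finset.exists_subset_card_eq
      (show s ≤ (Finset.univ \ (groupNodes μ n j ∪ groupUnion E)).card by omega)
    have hker := finrank_ker_inf_le hβ hα (by rw [mul_comm r]; omega) a (E := E) (fun _ => hI) hS.le
      (groupNodes μ n j) ((LinearMap.ker (f.domRestrict V)).map V.subtype)
      (by rintro _ ⟨v, -, rfl⟩; exact v.2)
      (by
        rintro _ ⟨v, hv, rfl⟩ x hx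
        exact congrFun (LinearMap.mem_ker.1 hv) ⟨x, hx⟩)
    rw [Submodule.finrank_map_subtype_eq, ← Finset.union_assoc, ← Finset.sup_eq_union,
      ← sdiff_sdiff_left, Finset.card_sdiff_of_subset hSE, hS] at hker
    have hrank := LinearMap.finrank_range_add_finrank_ker (f.domRestrict V)
    rw [LinearMap.range_domRestrict] at hrank
    have := le_finrank_row (K := K) (r := r) (s := s) (q := Fintype.card F) (β := β) (α := α) a
    rw [← hV] at this
    omega
  rw [Submodule.eq_of_le_of_finrank_le hle (by rw [hDdim]; exact hdim)]

/-- Any `r` erasures per group leave an MDS code. -/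
theorem isMDS_restrict_sdiff (hβ : Function.Injective (Function.uncurry β))
    (hα : Admissible r s β fun x : Fin μ × Fin n => α x.1 x.2) (hrn : r < n) (hb : 0 < b)
    (hs : (n - r) + s ≤ (n - r) * μ) {E : Fin μ → Finset (Fin μ × Fin n)}
    (hE : ∀ j, E j ⊆ groupNodes μ n j ∧ (E j).card = r) :
    ((pmdsCode r s (Fintype.card F) β α).restrict
      (Finset.univ \ Finset.univ.biUnion E)).IsMDS (μ * n - r * μ) (μ * n - r * μ - s) (s + 1) := by
  classical
  have hN : (n - r) * μ = μ * n - r * μ := by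
    rw [Nat.sub_mul, mul_comm n]
  let E' : Fin μ → Finset (Fin n) := fun j => (E j).image Prod.snd
  have hE' : ∀ j, (E' j).card = r := by
    intro j
    rw [Finset.card_image_of_injOn, (hE j).2]
    intro x hx y hy hxy
    have h1 := mem_groupNodes.1 ((hE j).1 hx)
    have h2 := mem_groupNodes.1 ((hE j).1 hy)
    exact Prod.ext (h1.trans h2.symm) hxy
  have hEE' : Finset.univ.biUnion E = groupUnion E' := by
    ext ⟨j, i⟩
    simp only [Finset.mem_biUnion, Finset.mem_univ, true_and, mem_groupUnion, E',
      Finset.mem_image, Prod.exists, exists_eq_right]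
    constructor
    · rintro ⟨j', hj'⟩
      obtain rfl : j = j' := mem_groupNodes.1 ((hE j').1 hj')
      exact ⟨j, hj'⟩
    · rintro ⟨j', hj'⟩
      exact ⟨j, by
        obtain rfl : j' = j := mem_groupNodes.1 ((hE j).1 hj')
        exact hj'⟩
  rw [hEE']
  have hcard : (groupUnion E').card = μ * r := by
    rw [card_groupUnion]; simp [hE']
  refine ArrayCode.isMDS_of_rows (ArrayCode.mem_restrict_iff_rows mem_pmdsCode_iff_rows _)
    ?_ (by omega) (by omega) (pow_pos hb n) (by omega) (fun a => ?_) (fun a v hv T hT hvT => ?_)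
  · rw [Fintype.card_coe, Finset.card_sdiff_of_subset (Finset.subset_univ _), hcard,
      Finset.card_univ]
    simp [mul_comm]
  · rw [finrank_map_of_forall_eq_zero, finrank_row hβ hα hrn.le (by omega), hN]
    intro v hv hv0
    refine eq_zero_of_admissible hβ hα (by omega) hv hE' (S := ∅) (by simp) fun x hx => Or.inl ?_
    by_contra hxE
    exact hx (congrFun hv0 ⟨x, by simpa using hxE⟩)
  · obtain ⟨w, hw, rfl⟩ := hv
    have : w = 0 := by
      refine eq_zero_of_admissible hβ hα (by omega) hw hE' (S := T.image Subtype.val)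
        (Finset.card_image_le.trans (by omega)) fun x hx => ?_
      by_contra hcon
      push Not at hcon
      have hxR : x ∈ Finset.univ \ groupUnion E' := by simpa using hcon.1
      exact hcon.2 (Finset.mem_image.2 ⟨⟨x, hxR⟩, hvT ⟨x, hxR⟩ hx, rfl⟩)
    rw [this, map_zero]

/-- An admissible family of elements of the large field yields a PMDS code all of whose local codes
are MSR. -/
theorem isLocallyMSRPMDS_of_admissible [Fintype K] {d : ℕ}
    (hβ : Function.Injective (Function.uncurry β))
    (hα : Admissible r s β fun x : Fin μ × Fin n => α x.1 x.2) (hμ : 0 < μ) (hr : 0 < r)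
    (hs : 0 < s) (hrn : r < n) (hsn : (n - r) + s ≤ (n - r) * μ) (hd : n - r ≤ d) (hdn : d < n)
    (hb : b = d + 1 - (n - r)) :
    ArrayCode.IsLocallyMSRPMDS μ n r s 1 d (b ^ n) (pmdsCode r s (Fintype.card F) β α) := by
  have hb0 : 0 < b := by omega
  have hβK : Function.Injective (Function.uncurry fun i t => algebraMap F K (β i t)) := fun x y h =>
    hβ ((algebraMap F K).injective h)
  have hloc := isLocalCode_restrict (K := K) hβ hα hrn.le hsn
  refine ⟨groupNodes μ n, ⟨⟨hμ, by omega, hr, hs, pow_pos hb0 n⟩, hrn.le, by omega, by simp, ?_, ?_,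
    ?_, card_groupNodes μ n, fun j => (hloc j).isMDS hβK hrn hb0, fun E hE =>
      isMDS_restrict_sdiff hβ hα hrn hb0 hsn hE⟩, fun j => (hloc j).isMSR hβK hr hrn hd hdn hb⟩
  · rw [ArrayCode.HasDim, ArrayCode.finrank_of_rows mem_pmdsCode_iff_rows]
    simp [finrank_row hβ hα hrn.le (show s ≤ (n - r) * μ by omega), mul_comm]
  · intro i j hij
    rw [Finset.disjoint_left]
    intro x hx hx'
    exact hij ((mem_groupNodes.1 hx).symm.trans (mem_groupNodes.1 hx'))
  · ext x
    simp

end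

/-! ### Passing to an extension field -/

/-- Vectors of length `M` over `F` that form an admissible family can be read as elements of the
extension field of degree `M`. -/
theorem exists_code_of_admissible {p : ℕ} [Fact p.Prime] (F : Type) [Field F] [Fintype F]
    [CharP F p] {μ n r s d M : ℕ} (hμ : 0 < μ) (hr : 0 < r) (hs : 0 < s) (hrn : r < n)
    (hsn : (n - r) + s ≤ (n - r) * μ) (hd : n - r ≤ d) (hdn : d < n) (hM : 0 < M)
    {β : Fin n → Fin (d + 1 - (n - r)) → F} {A : Fin μ × Fin n → Fin M → F}
    (hβ : Function.Injective (Function.uncurry β)) (hA : Admissible r s β A)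
    (hbound : Fintype.card F ^ M ≤
      2 * n * (d + 1 - (n - r)) * (2 * n * μ) ^ (s * (r + 1) - 1)) :
    ∃ q M : ℕ, IsPrimePow q ∧ 0 < M ∧ (d + 1 - (n - r)) * n ≤ q ∧
      q ^ M ≤ 2 * n * (d + 1 - (n - r)) * (2 * n * μ) ^ (s * (r + 1) - 1) ∧
      ∃ (F K : Type) (_ : Field F) (_ : Field K) (_ : Algebra F K),
        Nat.card F = q ∧ Nat.card K = q ^ M ∧
        ∃ (β : Fin n → Fin (d + 1 - (n - r)) → F) (α : Fin μ → Fin n → K),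
          Function.Injective (Function.uncurry β) ∧
          ArrayCode.IsLocallyMSRPMDS μ n r s 1 d ((d + 1 - (n - r)) ^ n)
            (pmdsCode r s q β α) := by
  have : NeZero M := ⟨hM.ne'⟩
  let K := FiniteField.Extension F p M
  have : Fintype K := Fintype.ofFinite K
  let B : Module.Basis (Fin M) F K :=
    Module.finBasisOfFinrankEq F K (FiniteField.finrank_extension F p M)
  let α : Fin μ → Fin n → K := fun j i => B.equivFun.symm (A (j, i))
  have hα : Admissible r s β fun x : Fin μ × Fin n => α x.1 x.2 := by
    intro dg v E S hl hE hS hSE hv h0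
    refine hA dg v E S hl hE hS hSE hv (B.equivFun.symm.injective ?_)
    simpa [α] using h0
  refine ⟨Fintype.card F, M, FiniteField.isPrimePow_card F, hM, ?_, hbound, F, K, inferInstance,
    inferInstance, inferInstance, Nat.card_eq_fintype_card, ?_, β, α, hβ,
    isLocallyMSRPMDS_of_admissible hβ hα hμ hr hs hrn hsn hd hdn rfl⟩
  · have := Fintype.card_le_of_injective _ hβ
    simpa [mul_comm] using this
  · rw [FiniteField.natCard_extension, Nat.card_eq_fintype_card]

/-- There are finite fields of characteristic two of a size between `x` and `2 * x`. -/
theorem exists_field_card {x : ℕ} (hx : 2 ≤ x) :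
    ∃ (F : Type) (_ : Field F) (_ : Fintype F) (_ : CharP F 2),
      x ≤ Fintype.card F ∧ Fintype.card F < 2 * x := by
  have ht : Nat.clog 2 x ≠ 0 := (Nat.clog_pos (by norm_num) hx).ne'
  have : Fintype (GaloisField 2 (Nat.clog 2 x)) := Fintype.ofFinite _
  have hcard : Fintype.card (GaloisField 2 (Nat.clog 2 x)) = 2 ^ Nat.clog 2 x := by
    rw [← Nat.card_eq_fintype_card, GaloisField.card 2 _ ht]
  refine ⟨GaloisField 2 (Nat.clog 2 x), inferInstance, inferInstance, inferInstance, ?_, ?_⟩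
  · rw [hcard]
    exact Nat.le_pow_clog (by norm_num) x
  · rw [hcard]
    have h := Nat.pow_pred_clog_lt_self (b := 2) (by norm_num) (x := x) (by omega)
    obtain ⟨t, ht'⟩ := Nat.exists_eq_succ_of_ne_zero ht
    rw [ht'] at h ⊢
    rw [Nat.pow_succ]
    simp only [Nat.pred_succ] at h
    omega

/-! ### Greedy choice of coefficients -/

/-- The vectors of `U` with value `1` at `y` lie in a coset of a proper subspace. -/
theorem card_filter_apply_eq_one_le {F ι : Type*} [Field F] [Fintype F] [Fintype ι]
    (U : Submodule F (ι → F)) {e : ℕ} (hU : Module.finrank F U ≤ e) (y : ι) :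
    Nat.card {v : U // (v : ι → F) y = 1} ≤ Fintype.card F ^ (e - 1) := by
  classical
  rcases isEmpty_or_nonempty {v : U // (v : ι → F) y = 1} with h | ⟨v₀, hv₀⟩
  · simp
  · let U₀ : Submodule F U := LinearMap.ker ((LinearMap.proj y).comp U.subtype)
    have hv₀U : v₀ ∉ U₀ := by
      intro h
      have : (v₀ : ι → F) y = 0 := h
      rw [hv₀] at this
      exact one_ne_zero this
    have hlt : Module.finrank F U₀ < Module.finrank F U := by
      refine Submodule.finrank_lt ?_
      exact fun h => hv₀U (h ▸ Submodule.mem_top)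
    have hinj : Function.Injective fun v : {v : U // (v : ι → F) y = 1} =>
        (⟨v.1 - v₀, by
          change ((v.1 : U) : ι → F) y - (v₀ : ι → F) y = 0
          rw [v.2, hv₀, sub_self]⟩ : U₀) := by
      intro v w h
      exact Subtype.ext (sub_left_injective (congrArg Subtype.val h))
    refine (Nat.card_le_card_of_injective _ hinj).trans ?_
    rw [Module.natCard_eq_pow_finrank (K := F), Nat.card_eq_fintype_card]
    exact Nat.pow_le_pow_right Fintype.card_pos (by omega)

/-- Given few subspaces of dimension at most `e`, each living on its own set of coordinates, there
are vectors of length `m` none of whose combinations with coefficients in one of the subspaces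
vanishes. They are chosen one after the other; at each step every subspace rules out at most
`q ^ (e - 1)` vectors. -/
theorem exists_coeffs_of_family {F ι κ : Type*} [Field F] [Fintype F] [Fintype ι]
    [Fintype κ] (U : κ → Submodule F (ι → F)) (T : κ → Finset ι) {e m P : ℕ}
    (hU : ∀ k, Module.finrank F (U k) ≤ e) (hT : ∀ k, ∀ v ∈ U k, ∀ x, v x ≠ 0 → x ∈ T k)
    (hP : ∀ x, Nat.card {k // x ∈ T k} ≤ P)
    (hlt : P * Fintype.card F ^ (e - 1) < Fintype.card F ^ m) :
    ∃ A : ι → Fin m → F, ∀ k, ∀ v ∈ U k, ∑ x, v x • A x = 0 → v = 0 := by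
  classical
  suffices h : ∀ J : Finset ι, ∃ A : ι → Fin m → F, ∀ k, ∀ v ∈ U k, (∀ x, v x ≠ 0 → x ∈ J) →
      ∑ x, v x • A x = 0 → v = 0 by
    obtain ⟨A, hA⟩ := h Finset.univ
    exact ⟨A, fun k v hv => hA k v hv fun x _ => Finset.mem_univ x⟩
  intro J
  induction J using Finset.induction_on with
  | empty =>
    refine ⟨0, fun k v _ hv _ => funext fun x => ?_⟩
    by_contra h
    simpa using hv x h
  | insert y J _ ih =>
    obtain ⟨A, hA⟩ := ih
    let bad : (Σ k : {k // y ∈ T k}, {v : U k // (v : ι → F) y = 1}) → (Fin m → F) :=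
      fun z => -∑ x ∈ Finset.univ.erase y, (z.2.1 : ι → F) x • A x
    have hbad : ∃ a, ∀ z, bad z ≠ a := by
      by_contra hcon
      push Not at hcon
      have h1 := Nat.card_le_card_of_surjective bad hcon
      rw [Nat.card_sigma] at h1
      have h2 : ∑ k : {k // y ∈ T k}, Nat.card {v : U k // (v : ι → F) y = 1}
          ≤ P * Fintype.card F ^ (e - 1) := by
        refine (Finset.sum_le_card_nsmul Finset.univ _ _ fun (k : {k // y ∈ T k}) _ =>
          card_filter_apply_eq_one_le (U k) (hU k) y).trans ?_
        rw [smul_eq_mul, Finset.card_univ, ← Nat.card_eq_fintype_card]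
        exact Nat.mul_le_mul_right _ (hP y)
      have h3 : Nat.card (Fin m → F) = Fintype.card F ^ m := by simp
      omega
    obtain ⟨a, ha⟩ := hbad
    refine ⟨Function.update A y a, fun k v hv hvJ h0 => ?_⟩
    have hrest : ∀ v : ι → F, ∑ x, v x • Function.update A y a x
        = v y • a + ∑ x ∈ Finset.univ.erase y, v x • A x := by
      intro v
      rw [← Finset.add_sum_erase _ _ (Finset.mem_univ y), Function.update_self]
      congr 1
      refine Finset.sum_congr rfl fun x hx => ?_
      rw [Function.update_of_ne (Finset.ne_of_mem_erase hx)]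
    rw [hrest] at h0
    by_cases hvy : v y = 0
    · refine hA k v hv (fun x hx => ?_) ?_
      · exact (Finset.mem_insert.1 (hvJ x hx)).resolve_left fun h => hx (h ▸ hvy)
      · rw [← Finset.add_sum_erase _ _ (Finset.mem_univ y), hvy, zero_smul, zero_add]
        rwa [hvy, zero_smul, zero_add] at h0
    · exfalso
      refine ha ⟨⟨k, hT k v hv y hvy⟩, ⟨⟨(v y)⁻¹ • v, (U k).smul_mem _ hv⟩, ?_⟩⟩ ?_
      · simp [hvy]
      · have h1 := congrArg (fun z => (v y)⁻¹ • z) h0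
        simp only [smul_add, smul_zero, smul_smul, inv_mul_cancel₀ hvy, one_smul,
          Finset.smul_sum] at h1
        simp only [bad, Pi.smul_apply, smul_eq_mul]
        exact (eq_neg_of_add_eq_zero_left h1).symm

/-- The vectors in `Y` that live on the nodes in `T` and satisfy the local checks for the digits
`D x`, which may depend on the group of the node. -/
def patternSpace {F : Type*} [Field F] {μ n b : ℕ} (r : ℕ) (β : Fin n → Fin b → F)
    (Y : Submodule F (Fin μ × Fin n → F)) (T : Finset (Fin μ × Fin n))
    (D : Fin μ × Fin n → Fin b) : Submodule F (Fin μ × Fin n → F) where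
  carrier := {v | v ∈ Y ∧ (∀ x, v x ≠ 0 → x ∈ T) ∧
    ∀ j, LocalCheck r β (fun i => D (j, i)) fun i => v (j, i)}
  add_mem' := by
    rintro v w ⟨hv1, hv2, hv3⟩ ⟨hw1, hw2, hw3⟩
    refine ⟨Y.add_mem hv1 hw1, fun x hx => ?_, fun j k hk => ?_⟩
    · by_contra h
      exact hx (by simp [not_imp_comm.1 (hv2 x) h, not_imp_comm.1 (hw2 x) h])
    · simp only [Pi.add_apply, add_mul, Finset.sum_add_distrib, hv3 j k hk, hw3 j k hk, add_zero]
  zero_mem' := ⟨Y.zero_mem, fun x hx => absurd rfl hx, fun j k _ => by simp⟩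
  smul_mem' := by
    rintro y v ⟨hv1, hv2, hv3⟩
    refine ⟨Y.smul_mem y hv1, fun x hx => hv2 x fun h => hx (by simp [h]), fun j k hk => ?_⟩
    simp only [Pi.smul_apply, smul_eq_mul, mul_assoc]
    rw [← Finset.mul_sum, hv3 j k hk, mul_zero]

theorem card_subtype_mem_powersetCard {ι : Type*} [Fintype ι] [DecidableEq ι] (y : ι) {W : ℕ}
    (hW : 1 ≤ W) : Nat.card {T : {T : Finset ι // T.card = W} // y ∈ T.1}
      = (Fintype.card ι - 1).choose (W - 1) := by
  have h := Finset.card_filter_powersetCard_subset {y} Finset.univ W (by simp) (by simpa using hW)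
  rw [Finset.card_singleton, Finset.card_univ] at h
  rw [← h, ← Fintype.card_coe, ← Nat.card_eq_fintype_card]
  exact Nat.card_congr
    { toFun := fun T => ⟨T.1.1, by simpa using ⟨T.1.2, T.2⟩⟩
      invFun := fun T => ⟨⟨T.1, (by simpa using T.2 : T.1.card = W ∧ y ∈ T.1).1⟩,
        (by simpa using T.2 : T.1.card = W ∧ y ∈ T.1).2⟩
      left_inv := fun _ => rfl
      right_inv := fun _ => rfl }

/-- Coefficients that separate all vectors with `W` active nodes whose pattern of nodes and digits
leaves at most `e` degrees of freedom. -/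
theorem exists_coeffs_of_patterns {F : Type*} [Field F] [Fintype F] {μ n b : ℕ} (r : ℕ)
    (β : Fin n → Fin b → F) (Y : Submodule F (Fin μ × Fin n → F)) (hb : 0 < b) {W e m : ℕ}
    (hW : 1 ≤ W) (hlt : (μ * n - 1).choose (W - 1) * b ^ W * Fintype.card F ^ (e - 1)
      < Fintype.card F ^ m) :
    ∃ A : Fin μ × Fin n → Fin m → F, ∀ (T : Finset (Fin μ × Fin n)) (D : Fin μ × Fin n → Fin b),
      T.card = W → Module.finrank F (patternSpace r β Y T D) ≤ e →
      ∀ v ∈ patternSpace r β Y T D, ∑ x, v x • A x = 0 → v = 0 := by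
  classical
  -- the digits are only prescribed on `T`, to keep the number of patterns small
  let ext : (Σ T : {T : Finset (Fin μ × Fin n) // T.card = W}, (T.1 → Fin b)) →
      Fin μ × Fin n → Fin b := fun z x => if h : x ∈ z.1.1 then z.2 ⟨x, h⟩ else ⟨0, hb⟩
  let U : (Σ T : {T : Finset (Fin μ × Fin n) // T.card = W}, (T.1 → Fin b)) →
      Submodule F (Fin μ × Fin n → F) := fun z =>
    if Module.finrank F (patternSpace r β Y z.1 (ext z)) ≤ e then patternSpace r β Y z.1 (ext z)
    else ⊥
  have hUle : ∀ z, U z ≤ patternSpace r β Y z.1 (ext z) := by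
    intro z
    by_cases h : Module.finrank F (patternSpace r β Y z.1 (ext z)) ≤ e <;> simp [U, h]
  have hfin : ∀ z, Module.finrank F (U z) ≤ e := by
    intro z
    by_cases h : Module.finrank F (patternSpace r β Y z.1 (ext z)) ≤ e
    · rwa [show U z = _ from if_pos h]
    · rw [show U z = ⊥ from if_neg h, finrank_bot]
      exact Nat.zero_le e
  have hP : ∀ x, Nat.card {z : Σ T : {T : Finset (Fin μ × Fin n) // T.card = W}, (T.1 → Fin b) //
      x ∈ z.1.1} ≤ (μ * n - 1).choose (W - 1) * b ^ W := by
    intro x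
    let f : {z : Σ T : {T : Finset (Fin μ × Fin n) // T.card = W}, (T.1 → Fin b) // x ∈ z.1.1} ≃
        Σ T : {T : {T : Finset (Fin μ × Fin n) // T.card = W} // x ∈ T.1}, (T.1.1 → Fin b) :=
      { toFun := fun z => ⟨⟨z.1.1, z.2⟩, z.1.2⟩
        invFun := fun z => ⟨⟨z.1.1, z.2⟩, z.1.2⟩
        left_inv := fun _ => rfl
        right_inv := fun _ => rfl }
    rw [Nat.card_congr f, Nat.card_sigma]
    have h1 : ∀ T : {T : {T : Finset (Fin μ × Fin n) // T.card = W} // x ∈ T.1},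
        Nat.card (T.1.1 → Fin b) = b ^ W := by
      intro T
      simp [T.1.2]
    simp only [h1, Finset.sum_const, smul_eq_mul, Finset.card_univ]
    rw [← Nat.card_eq_fintype_card, card_subtype_mem_powersetCard x hW]
    simp
  obtain ⟨A, hA⟩ := exists_coeffs_of_family U (fun z => z.1.1) hfin
    (fun z v hv => (hUle z hv).2.1) hP hlt
  refine ⟨A, fun T D hT he v hv h0 => ?_⟩
  let z : Σ T : {T : Finset (Fin μ × Fin n) // T.card = W}, (T.1 → Fin b) :=
    ⟨⟨T, hT⟩, fun x => D x⟩
  have heq : patternSpace r β Y T D = patternSpace r β Y T (ext z) := by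
    ext w
    refine and_congr_right fun _ => and_congr_right fun hw => forall_congr' fun j =>
      forall_congr' fun k => forall_congr' fun _ => ?_
    suffices h : ∀ i, w (j, i) * β i (D (j, i)) ^ k = w (j, i) * β i (ext z (j, i)) ^ k by
      simp only [h]
    intro i
    by_cases h : (j, i) ∈ T
    · simp [ext, z, h]
    · rw [not_imp_comm.1 (hw (j, i)) h, zero_mul, zero_mul]
  refine hA z v ?_ h0
  rw [heq] at he hv
  simpa [U, z, he] using hv

/-! ### Constructions of admissible families -/

/-- There are nodes `β` in a finite field of characteristic two and an admissible family of vectors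
of length `M`, read as elements of an extension field of size at most `B`. -/
def HasScheme (μ n r s b B : ℕ) : Prop :=
  ∃ (F : Type) (_ : Field F) (_ : Fintype F) (_ : CharP F 2) (M : ℕ) (β : Fin n → Fin b → F)
    (A : Fin μ × Fin n → Fin M → F), 0 < M ∧ Fintype.card F ^ M ≤ B ∧
      Function.Injective (Function.uncurry β) ∧ Admissible r s β A

theorem exists_injective_uncurry {F : Type*} [Fintype F] {n b : ℕ} (h : n * b ≤ Fintype.card F) :
    ∃ β : Fin n → Fin b → F, Function.Injective (Function.uncurry β) := by
  obtain ⟨f⟩ : Nonempty (Fin n × Fin b ↪ F) :=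
    Function.Embedding.nonempty_of_card_le (by simpa using h)
  exact ⟨fun i t => f (i, t), f.injective⟩

/-- The nodes of an erasure pattern that lie in `S` or in an erased set of a group in `J`. -/
def pattern {μ n : ℕ} (E : Fin μ → Finset (Fin n)) (S : Finset (Fin μ × Fin n))
    (J : Finset (Fin μ)) : Finset (Fin μ × Fin n) :=
  groupUnion (fun j => if j ∈ J then E j else ∅) ∪ S

theorem mem_pattern {μ n : ℕ} {E : Fin μ → Finset (Fin n)} {S : Finset (Fin μ × Fin n)}
    {J : Finset (Fin μ)} {x : Fin μ × Fin n} :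
    x ∈ pattern E S J ↔ (x.1 ∈ J ∧ x.2 ∈ E x.1) ∨ x ∈ S := by
  by_cases h : x.1 ∈ J <;> simp [pattern, h]

theorem card_pattern {μ n r : ℕ} {E : Fin μ → Finset (Fin n)} (hE : ∀ j, (E j).card = r)
    {S : Finset (Fin μ × Fin n)} (hSE : ∀ x ∈ S, x.2 ∉ E x.1) (J : Finset (Fin μ)) :
    (pattern E S J).card = J.card * r + S.card := by
  rw [pattern, Finset.card_union_of_disjoint, card_groupUnion]
  · congr 1
    have h : ∀ j, (if j ∈ J then E j else ∅).card = if j ∈ J then r else 0 := by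
      intro j
      by_cases h : j ∈ J <;> simp [h, hE]
    simp [h]
  · rw [Finset.disjoint_right]
    intro x hx hxE
    by_cases h : x.1 ∈ J <;> simp [h] at hxE
    exact hSE x hx hxE

section

variable {F : Type*} [Field F] {μ n b r s : ℕ} {β : Fin n → Fin b → F}

/-- A group none of whose active nodes is in `S` is inactive. -/
theorem LocalCheck.eq_zero_of_forall_mem (hβ : Function.Injective (Function.uncurry β))
    {dg : Fin n → Fin b} {v : Fin μ × Fin n → F} {E : Fin μ → Finset (Fin n)}
    {S : Finset (Fin μ × Fin n)} (hE : ∀ j, (E j).card = r) {j : Fin μ}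
    (hl : LocalCheck r β dg fun i => v (j, i)) (hv : ∀ x, v x ≠ 0 → x.2 ∈ E x.1 ∨ x ∈ S)
    (hS : ∀ x ∈ S, x.1 = j → v x = 0) (i : Fin n) : v (j, i) = 0 := by
  refine congrFun (hl.eq_zero hβ (hE j).le fun i hi => ?_) i
  exact (hv (j, i) hi).resolve_right fun h => hi (hS _ h rfl)

/-- If only the groups in `J` are active, then all active nodes are in the pattern of `J`. -/
theorem mem_pattern_of_ne_zero {v : Fin μ × Fin n → F} {E : Fin μ → Finset (Fin n)}
    {S : Finset (Fin μ × Fin n)} (hv : ∀ x, v x ≠ 0 → x.2 ∈ E x.1 ∨ x ∈ S) {J : Finset (Fin μ)}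
    (hJ : ∀ j, j ∉ J → ∀ i, v (j, i) = 0) (x : Fin μ × Fin n) (hx : v x ≠ 0) :
    x ∈ pattern E S J := by
  rw [mem_pattern]
  have h : x.1 ∈ J := by
    by_contra h
    exact hx (hJ x.1 h x.2)
  exact (hv x hx).imp_left fun h' => ⟨h, h'⟩

/-- For `b ≤ μ` the powers of distinct field elements form an admissible family: the number of
active nodes is at most `s * (r + 1)`, and the exponent `0` is taken care of by the local checks. -/
theorem hasScheme_of_le {μ n r s b : ℕ} (hμ : 2 ≤ μ) (hr : 0 < r) (hs : 0 < s) (hb : 0 < b)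
    (hn : 0 < n) (hbμ : b ≤ μ) :
    HasScheme μ n r s b (2 * n * b * (2 * n * μ) ^ (s * (r + 1) - 1)) := by
  classical
  have hμn : 2 ≤ μ * n := le_trans hμ (Nat.le_mul_of_pos_right μ hn)
  obtain ⟨F, _, _, _, hq1, hq2⟩ := exists_field_card hμn
  obtain ⟨β, hβ⟩ := exists_injective_uncurry (F := F) (n := n) (b := b) (by
    rw [mul_comm]; exact (Nat.mul_le_mul_right n hbμ).trans hq1)
  obtain ⟨X⟩ : Nonempty (Fin μ × Fin n ↪ F) :=
    Function.Embedding.nonempty_of_card_le (by simpa using hq1)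
  have hM : 0 < s * (r + 1) - 1 := by
    have : 1 * 2 ≤ s * (r + 1) := Nat.mul_le_mul hs (by omega)
    omega
  refine ⟨F, inferInstance, inferInstance, inferInstance, s * (r + 1) - 1, β,
    fun x m => X x ^ ((m : ℕ) + 1), hM, ?_, hβ, ?_⟩
  · have h1 : Fintype.card F ≤ 2 * n * μ := by rw [mul_assoc, mul_comm n]; exact hq2.le
    refine (Nat.pow_le_pow_left h1 _).trans (Nat.le_mul_of_pos_left _ ?_)
    positivity
  · intro dg v E S hl hE hS hSE hv h0
    have hJ : ∀ j, j ∉ S.image Prod.fst → ∀ i, v (j, i) = 0 := fun j hj =>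
      (hl j).eq_zero_of_forall_mem hβ hE hv fun x hx hxj =>
        absurd (Finset.mem_image.2 ⟨x, hx, hxj⟩) hj
    refine eq_zero_of_support_subset (I := pattern E S (S.image Prod.fst)) (m := s * (r + 1))
      X.injective.injOn ?_ (mem_pattern_of_ne_zero hv hJ) ?_
    · rw [card_pattern hE hSE, hS, mul_add, mul_one]
      have : (S.image Prod.fst).card ≤ s := hS ▸ Finset.card_image_le
      exact Nat.add_le_add_right (Nat.mul_le_mul_right r this) s
    · intro k hk
      rcases k with - | k
      · rw [Fintype.sum_prod_type]
        refine Finset.sum_eq_zero fun j _ => ?_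
        rw [← hl j 0 hr]
        simp
      · have := congrFun h0 ⟨k, by omega⟩
        simpa using this

/-- A vector that satisfies the local checks and vanishes on `S` lives on `r` nodes per group, so it
is zero. -/
theorem finrank_patternSpace_le (hβ : Function.Injective (Function.uncurry β))
    {E : Fin μ → Finset (Fin n)} (hE : ∀ j, (E j).card = r) (S : Finset (Fin μ × Fin n))
    (J : Finset (Fin μ)) (D : Fin μ × Fin n → Fin b) :
    Module.finrank F (patternSpace r β ⊤ (pattern E S J) D) ≤ S.card := by
  refine finrank_le_card_of_vanish _ _ fun v hv h => ?_
  funext ⟨j, i⟩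
  refine congrFun ((hv.2.2 j).eq_zero hβ (hE j).le fun i hi => ?_) i
  rcases mem_pattern.1 (hv.2.1 (j, i) hi) with h' | h'
  · exact h'.2
  · exact absurd (h _ h') hi

theorem exists_lt_pow_le_mul {q c : ℕ} (hq : 1 < q) (hc : c ≠ 0) :
    ∃ m, 0 < m ∧ c < q ^ m ∧ q ^ m ≤ c * q :=
  ⟨Nat.log q c + 1, Nat.succ_pos _, Nat.lt_pow_succ_log_self hq c, by
    rw [pow_succ]
    exact Nat.mul_le_mul_right q (Nat.pow_log_le_self q hc)⟩

/-- Greedy choice of the whole family over a field of size about `b * n`. All patterns with `s`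
further nodes are contained in one with `min s μ` groups. -/
theorem hasScheme_of_choose_mul_le {μ n r s b W : ℕ} (hs : 0 < s) (hb : 0 < b) (hn : 2 ≤ n)
    (hW : W = min s μ * r + s) (hWN : W ≤ μ * n)
    (h : (μ * n - 1).choose (W - 1) * b ^ W * (2 * (b * n)) ^ (s - 1)
      ≤ (2 * n * μ) ^ (s * (r + 1) - 1)) :
    HasScheme μ n r s b (2 * n * b * (2 * n * μ) ^ (s * (r + 1) - 1)) := by
  classical
  obtain ⟨F, _, _, _, hq1, hq2⟩ := exists_field_card
    (show 2 ≤ b * n from hn.trans (Nat.le_mul_of_pos_left n hb))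
  obtain ⟨β, hβ⟩ := exists_injective_uncurry (F := F) (n := n) (b := b) (by rwa [mul_comm])
  set q := Fintype.card F
  have hq : 1 < q := Fintype.one_lt_card
  have hcnt : (μ * n - 1).choose (W - 1) * b ^ W * q ^ (s - 1) ≠ 0 := by
    have := Nat.choose_pos (show W - 1 ≤ μ * n - 1 by omega)
    positivity
  obtain ⟨m, hm0, hm, hmle⟩ := exists_lt_pow_le_mul hq hcnt
  obtain ⟨A, hA⟩ := exists_coeffs_of_patterns r β ⊤ hb (by omega) hm
  refine ⟨F, inferInstance, inferInstance, inferInstance, m, β, A, hm0, hmle.trans ?_, hβ, ?_⟩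
  · obtain ⟨s', rfl⟩ : ∃ s', s = s' + 1 := ⟨s - 1, by omega⟩
    rw [Nat.add_sub_cancel] at h ⊢
    calc (μ * n - 1).choose (W - 1) * b ^ W * q ^ s' * q
        ≤ (μ * n - 1).choose (W - 1) * b ^ W * (2 * (b * n)) ^ s' * (2 * (b * n)) := by gcongr
      _ ≤ (2 * n * μ) ^ ((s' + 1) * (r + 1) - 1) * (2 * (b * n)) := Nat.mul_le_mul_right _ h
      _ = _ := by ring
  · intro dg v E S hl hE hS hSE hv h0
    have hle : (S.image Prod.fst).card ≤ min s μ := le_min (hS ▸ Finset.card_image_le)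
      (by simpa using Finset.card_le_univ (S.image Prod.fst))
    obtain ⟨J, hSJ, -, hJ⟩ := Finset.exists_subsuperset_card_eq (Finset.subset_univ _) hle
      (by simp)
    refine hA (pattern E S J) (fun x => dg x.2) ?_ ?_ v ?_ h0
    · rw [card_pattern hE hSE, hJ, hS, hW]
    · exact (finrank_patternSpace_le hβ hE S J _).trans hS.le
    · refine ⟨Submodule.mem_top, mem_pattern_of_ne_zero hv fun j hj => ?_, hl⟩
      exact (hl j).eq_zero_of_forall_mem hβ hE hv fun x hx hxj =>
        absurd (hSJ (Finset.mem_image.2 ⟨x, hx, hxj⟩)) hj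

end

/-! ### Nodes in the fibres of a polynomial -/

/-- A division-free form of `q.descFactorial r ≥ q ^ (r - 1) * (q - r.choose 2)`. -/
theorem pow_succ_le_mul_descFactorial (q r : ℕ) :
    q ^ (r + 1) ≤ q * q.descFactorial r + r.choose 2 * q ^ r := by
  induction r with
  | zero => simp
  | succ r ih =>
    have h1 : q * q.descFactorial r ≤ q.descFactorial (r + 1) + r * q ^ r := by
      rw [Nat.descFactorial_succ]
      calc q * q.descFactorial r ≤ ((q - r) + r) * q.descFactorial r :=
            Nat.mul_le_mul_right _ (by omega)
        _ = (q - r) * q.descFactorial r + r * q.descFactorial r := by ring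
        _ ≤ _ := by
            gcongr
            exact Nat.descFactorial_le_pow q r
    have h2 : (r + 1).choose 2 = r + r.choose 2 := by
      rw [Nat.choose_succ_succ' r 1, Nat.choose_one_right]
    calc q ^ (r + 1 + 1) = q * q ^ (r + 1) := by ring
      _ ≤ q * (q * q.descFactorial r + r.choose 2 * q ^ r) := Nat.mul_le_mul_left _ ih
      _ ≤ q * ((q.descFactorial (r + 1) + r * q ^ r) + r.choose 2 * q ^ r) := by gcongr
      _ = _ := by rw [h2]; ring

/-- For `q ≥ n * r ! + r.choose 2` there are on average `n` subsets of size `r` of a field with `q`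
elements per prescription of `r - 1` coefficients of a polynomial. -/
theorem mul_pow_le_choose {q n r : ℕ} (hr : 0 < r) (hq : n * r.factorial + r.choose 2 ≤ q)
    (hq0 : 0 < q) : q ^ (r - 1) * n ≤ q.choose r := by
  have h1 := pow_succ_le_mul_descFactorial q r
  have h2 : q ^ r * (n * r.factorial + r.choose 2) ≤ q ^ (r + 1) := by
    rw [pow_succ]; exact Nat.mul_le_mul_left _ hq
  rw [Nat.descFactorial_eq_factorial_mul_choose] at h1
  obtain ⟨r', rfl⟩ : ∃ r', r = r' + 1 := ⟨r - 1, by omega⟩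
  rw [Nat.add_sub_cancel]
  refine Nat.le_of_mul_le_mul_left ?_ (Nat.mul_pos hq0 (Nat.factorial_pos (r' + 1)))
  have h3 : q * (r' + 1).factorial * (q ^ r' * n) + (r' + 1).choose 2 * q ^ (r' + 1)
      = q ^ (r' + 1) * (n * (r' + 1).factorial + (r' + 1).choose 2) := by ring
  have h4 : q * (r' + 1).factorial * q.choose (r' + 1)
    = q * ((r' + 1).factorial * q.choose (r' + 1)) := by ring
  omega

/-- Nodes `β i t` at which one polynomial of degree `r` takes a value `γ i` that does not depend on
`t`: by the pigeonhole principle many sets of `r` field elements have the same elementary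
symmetric functions up to degree `r - 1`. -/
theorem exists_fibre_nodes {F : Type*} [Field F] [Fintype F] {n b r : ℕ} (hn : 0 < n)
    (hr : 0 < r) (hb : b ≤ r) (hq : n * r.factorial + r.choose 2 ≤ Fintype.card F) :
    ∃ (β : Fin n → Fin b → F) (γ : Fin n → F) (P : Polynomial F),
      Function.Injective (Function.uncurry β) ∧ P.Monic ∧ P.natDegree = r ∧
        ∀ i t, P.eval (β i t) = γ i := by
  classical
  let p : Finset F → Polynomial F := fun B => ∏ y ∈ B, (Polynomial.X - Polynomial.C y)
  have hpm : ∀ B, (p B).Monic := fun B => Polynomial.monic_prod_of_monic _ _ fun y _ =>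
    Polynomial.monic_X_sub_C y
  have hpd : ∀ B, (p B).natDegree = B.card := by
    intro B
    rw [Polynomial.natDegree_prod_of_monic _ _ fun j _ => Polynomial.monic_X_sub_C _]
    simp
  have hproot : ∀ B y, (p B).eval y = 0 ↔ y ∈ B := by
    intro B y
    rw [Polynomial.eval_prod, Finset.prod_eq_zero_iff]
    constructor
    · rintro ⟨z, hz, h⟩
      rw [Polynomial.eval_sub, Polynomial.eval_X, Polynomial.eval_C, sub_eq_zero] at h
      exact h ▸ hz
    · exact fun h => ⟨y, h, by simp⟩
  obtain ⟨c, -, hc⟩ := Finset.exists_le_card_fiber_of_mul_le_card_of_maps_to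
    (s := (Finset.univ : Finset F).powersetCard r) (t := (Finset.univ : Finset (Fin (r - 1) → F)))
    (f := fun B k => (p B).coeff (k + 1)) (n := n) (fun _ _ => Finset.mem_univ _)
    Finset.univ_nonempty (by
      rw [Finset.card_powersetCard, Finset.card_univ, Finset.card_univ, Fintype.card_fun,
        Fintype.card_fin]
      exact mul_pow_le_choose hr hq Fintype.card_pos)
  obtain ⟨B⟩ : Nonempty (Fin n ↪ {B // B ∈ ((Finset.univ : Finset F).powersetCard r).filter
      fun B => (fun k : Fin (r - 1) => (p B).coeff (k + 1)) = c}) :=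
    Function.Embedding.nonempty_of_card_le (by rw [Fintype.card_coe, Fintype.card_fin]; exact hc)
  have hBc : ∀ i, (B i).1.card = r := fun i =>
    (Finset.mem_powersetCard.1 (Finset.mem_filter.1 (B i).2).1).2
  have hBk : ∀ i k, k ≠ 0 → ∀ i', (p (B i).1).coeff k = (p (B i').1).coeff k := by
    intro i k hk i'
    rcases lt_trichotomy k r with h | h | h
    · have h1 := congrFun ((Finset.mem_filter.1 (B i).2).2.trans
        (Finset.mem_filter.1 (B i').2).2.symm) ⟨k - 1, by omega⟩
      simpa [Nat.sub_add_cancel (Nat.one_le_iff_ne_zero.2 hk)] using h1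
    · have h1 := (hpm (B i).1).coeff_natDegree
      have h2 := (hpm (B i').1).coeff_natDegree
      rw [hpd, hBc] at h1 h2
      rw [h, h1, h2]
    · rw [Polynomial.coeff_eq_zero_of_natDegree_lt (by rw [hpd, hBc]; exact h),
        Polynomial.coeff_eq_zero_of_natDegree_lt (by rw [hpd, hBc]; exact h)]
  -- polynomials of the fibre differ by constants only
  have hBp : ∀ i i', p (B i).1 - Polynomial.C ((p (B i).1).coeff 0)
      = p (B i').1 - Polynomial.C ((p (B i').1).coeff 0) := by
    intro i i'
    ext k
    rcases eq_or_ne k 0 with rfl | hk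
    · simp
    · simp only [Polynomial.coeff_sub, Polynomial.coeff_C_of_ne_zero hk, sub_zero]
      exact hBk i k hk i'
  have he : ∀ i, Nonempty (Fin b ↪ (B i).1) := fun i =>
    Function.Embedding.nonempty_of_card_le (by simpa [hBc] using hb)
  let e : ∀ i, Fin b ↪ (B i).1 := fun i => (he i).some
  let P : Fin n → Polynomial F := fun i => p (B i).1 - Polynomial.C ((p (B i).1).coeff 0)
  have hPeval : ∀ i, ∀ y ∈ (B i).1, (P ⟨0, hn⟩).eval y = -(p (B i).1).coeff 0 := by
    intro i y hy
    rw [show P ⟨0, hn⟩ = P i from hBp _ _]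
    simp [P, (hproot _ _).2 hy]
  refine ⟨fun i t => e i t, fun i => -(p (B i).1).coeff 0, P ⟨0, hn⟩, ?_, ?_, ?_,
    fun i t => hPeval i _ (e i t).2⟩
  · rintro ⟨i, t⟩ ⟨i', t'⟩ h
    have h : (e i t : F) = e i' t' := h
    have h1 := hPeval i _ (e i t).2
    rw [h, hPeval i' _ (e i' t').2] at h1
    have h2 : p (B i).1 = p (B i').1 := by
      have := hBp i i'
      rwa [← neg_injective h1, sub_left_inj] at this
    have h3 : i = i' := by
      refine B.injective (Subtype.ext ?_)
      ext y
      rw [← hproot, ← hproot, h2]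
    subst h3
    rw [(e i).injective (Subtype.ext h)]
  · refine (hpm _).sub_of_left (Polynomial.degree_C_le.trans_lt ?_)
    rw [← Polynomial.natDegree_pos_iff_degree_pos, hpd, hBc]
    exact hr
  · rw [Polynomial.natDegree_sub_C, hpd, hBc]

section

variable {F : Type*} [Field F] {μ n b r s : ℕ} {β : Fin n → Fin b → F}
  {γ : Fin n → F} {P : Polynomial F}

/-- For nodes in the fibres of a monic polynomial of degree `r`, orthogonality to its values is one
more local check. -/
theorem LocalCheck.succ_of_sum_mul_eq_zero (hP : P.Monic) (hPd : P.natDegree = r)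
    (hPγ : ∀ i t, P.eval (β i t) = γ i) {dg : Fin n → Fin b} {v : Fin n → F}
    (hl : LocalCheck r β dg v) (h0 : ∑ i, v i * γ i = 0) : LocalCheck (r + 1) β dg v := by
  intro k hk
  rcases Nat.lt_succ_iff_lt_or_eq.1 hk with hk | rfl
  · exact hl k hk
  · have h1 : ∀ i, v i * γ i = v i * β i (dg i) ^ k
        + ∑ l ∈ Finset.range k, P.coeff l * (v i * β i (dg i) ^ l) := by
      intro i
      rw [← hPγ i (dg i), Polynomial.eval_eq_sum_range, hPd, Finset.sum_range_succ, add_comm,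
        show P.coeff k = 1 by rw [← hPd]; exact hP.coeff_natDegree, mul_add, Finset.mul_sum,
        one_mul]
      congr 1
      exact Finset.sum_congr rfl fun l _ => by ring
    simp only [h1, Finset.sum_add_distrib] at h0
    rw [Finset.sum_comm, Finset.sum_eq_zero (s := Finset.range k), add_zero] at h0
    · exact h0
    · intro l hl'
      rw [← Finset.mul_sum, hl l (Finset.mem_range.1 hl'), mul_zero]

/-- The vectors whose restriction to every group is orthogonal to `γ`. -/
def groupOrthogonal {F : Type*} [Field F] (μ : ℕ) {n : ℕ} (γ : Fin n → F) :
    Submodule F (Fin μ × Fin n → F) where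
  carrier := {v | ∀ j, ∑ i, v (j, i) * γ i = 0}
  add_mem' := by
    intro v w hv hw j
    simp only [Pi.add_apply, add_mul, Finset.sum_add_distrib, hv j, hw j, add_zero]
  zero_mem' := by
    intro j
    simp
  smul_mem' := by
    intro y v hv j
    simp only [Pi.smul_apply, smul_eq_mul, mul_assoc]
    rw [← Finset.mul_sum, hv j, mul_zero]

/-- A group that satisfies the extra check and has at most one active node in `S` is inactive. -/
theorem LocalCheck.eq_zero_of_card_le_one (hβ : Function.Injective (Function.uncurry β))
    (hP : P.Monic) (hPd : P.natDegree = r) (hPγ : ∀ i t, P.eval (β i t) = γ i)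
    {dg : Fin n → Fin b} {v : Fin n → F} (hl : LocalCheck r β dg v) (h0 : ∑ i, v i * γ i = 0)
    {I : Finset (Fin n)} (hI : I.card = r) {i₀ : Fin n} (hv : ∀ i, v i ≠ 0 → i ∈ I ∨ i = i₀) :
    v = 0 :=
  (hl.succ_of_sum_mul_eq_zero hP hPd hPγ h0).eq_zero hβ (I := insert i₀ I)
    ((Finset.card_insert_le _ _).trans (by omega)) fun i hi => by
      rw [Finset.mem_insert]
      exact (hv i hi).symm

/-- The extra check saves one degree of freedom: it allows to drop any one node from `S`. -/
theorem finrank_patternSpace_groupOrthogonal_le (hβ : Function.Injective (Function.uncurry β))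
    (hP : P.Monic) (hPd : P.natDegree = r) (hPγ : ∀ i t, P.eval (β i t) = γ i)
    {E : Fin μ → Finset (Fin n)} (hE : ∀ j, (E j).card = r) {S : Finset (Fin μ × Fin n)}
    (hS : S.card = s) (hs : 0 < s) (J : Finset (Fin μ)) (D : Fin μ × Fin n → Fin b) :
    Module.finrank F (patternSpace r β (groupOrthogonal μ γ) (pattern E S J) D) ≤ s - 1 := by
  classical
  obtain ⟨x₀, hx₀⟩ := Finset.card_pos.1 (hS ▸ hs)
  rw [← hS, ← Finset.card_erase_of_mem hx₀]
  refine finrank_le_card_of_vanish _ _ fun v hv h => ?_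
  funext ⟨j, i⟩
  refine congrFun ((hv.2.2 j).eq_zero_of_card_le_one hβ hP hPd hPγ (hv.1 j) (hE j)
    (i₀ := x₀.2) fun i hi => ?_) i
  rcases mem_pattern.1 (hv.2.1 (j, i) hi) with h' | h'
  · exact Or.inl h'.2
  · by_cases hx : (j, i) = x₀
    · exact Or.inr (hx ▸ rfl)
    · exact absurd (h _ (Finset.mem_erase.2 ⟨hx, h'⟩)) hi

/-- Admissible families in two tiers. The first `s` coordinates force the extra local check in all
groups; then every active group meets `S` twice, so that the remaining coordinates only have to
separate patterns with `s / 2` groups. -/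
theorem admissible_append (hβ : Function.Injective (Function.uncurry β))
    (hP : P.Monic) (hPd : P.natDegree = r) (hPγ : ∀ i t, P.eval (β i t) = γ i) (hs : 0 < s)
    (hsμ : s / 2 ≤ μ) {z : Fin μ → F} (hz : Function.Injective z) {m : ℕ}
    {A : Fin μ × Fin n → Fin m → F}
    (hA : ∀ (T : Finset (Fin μ × Fin n)) (D : Fin μ × Fin n → Fin b),
      T.card = s / 2 * r + s →
      Module.finrank F (patternSpace r β (groupOrthogonal μ γ) T D) ≤ s - 1 →
      ∀ v ∈ patternSpace r β (groupOrthogonal μ γ) T D, ∑ x, v x • A x = 0 → v = 0) :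
    Admissible r s β fun x => Fin.append (fun u : Fin s => z x.1 ^ (u : ℕ) * γ x.2) (A x) := by
  classical
  intro dg v E S hl hE hS hSE hv h0
  have hA0 : ∑ x, v x • A x = 0 := by
    funext k
    have := congrFun h0 (Fin.natAdd s k)
    simpa using this
  have hY : (fun j => ∑ i, v (j, i) * γ i) = 0 := by
    refine eq_zero_of_support_subset (I := S.image Prod.fst) (m := s) (x := z) hz.injOn
      (hS ▸ Finset.card_image_le) (fun j hj => ?_) fun k hk => ?_
    · by_contra hjS
      refine hj (Finset.sum_eq_zero fun i _ => ?_)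
      rw [(hl j).eq_zero_of_forall_mem hβ hE hv (fun x hx hxj =>
        absurd (Finset.mem_image.2 ⟨x, hx, hxj⟩) hjS), zero_mul]
    · have := congrFun h0 (Fin.castAdd m ⟨k, hk⟩)
      simp only [Finset.sum_apply, Pi.smul_apply, Fin.append_left, smul_eq_mul,
        Pi.zero_apply, Fintype.sum_prod_type] at this
      rw [← this]
      refine Finset.sum_congr rfl fun j _ => ?_
      rw [Finset.sum_mul]
      exact Finset.sum_congr rfl fun i _ => by ring
  let J₀ : Finset (Fin μ) := Finset.univ.filter fun j => ∃ i, v (j, i) ≠ 0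
  have hJ₀S : ∀ j ∈ J₀, 2 ≤ (S.filter fun x => x.1 = j).card := by
    intro j hj
    by_contra hlt
    obtain ⟨i, hi⟩ := (Finset.mem_filter.1 hj).2
    have h1 : ∃ i₀, ∀ x ∈ S, x.1 = j → x.2 = i₀ := by
      rcases (S.filter fun x => x.1 = j).eq_empty_or_nonempty with he | ⟨x₀, hx₀⟩
      · refine ⟨i, fun x hx hxj => ?_⟩
        have : x ∈ S.filter fun x => x.1 = j := Finset.mem_filter.2 ⟨hx, hxj⟩
        rw [he] at this
        simp at this
      · refine ⟨x₀.2, fun x hx hxj => ?_⟩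
        rw [Finset.card_le_one.1 (by omega : (S.filter fun x => x.1 = j).card ≤ 1) x
          (Finset.mem_filter.2 ⟨hx, hxj⟩) x₀ hx₀]
    obtain ⟨i₀, hi₀⟩ := h1
    refine hi (congrFun ((hl j).eq_zero_of_card_le_one hβ hP hPd hPγ (congrFun hY j) (hE j)
      (i₀ := i₀) fun i hi => ?_) i)
    exact (hv (j, i) hi).imp_right fun h => hi₀ _ h rfl
  have hJ₀ : J₀.card ≤ s / 2 := by
    rw [Nat.le_div_iff_mul_le (by norm_num), ← hS]
    refine (Finset.card_nsmul_le_sum J₀ _ 2 hJ₀S).trans ?_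
    rw [← Finset.card_biUnion]
    · refine Finset.card_le_card fun x hx => ?_
      obtain ⟨j, -, hj⟩ := Finset.mem_biUnion.1 hx
      exact (Finset.mem_filter.1 hj).1
    · intro j _ j' _ hjj'
      rw [Function.onFun, Finset.disjoint_left]
      exact fun x hx hx' => hjj' ((Finset.mem_filter.1 hx).2.symm.trans (Finset.mem_filter.1 hx').2)
  obtain ⟨J, hJ₀J, -, hJ⟩ := Finset.exists_subsuperset_card_eq (Finset.subset_univ J₀) hJ₀
    (by simpa using hsμ)
  refine hA (pattern E S J) (fun x => dg x.2) ?_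
    (finrank_patternSpace_groupOrthogonal_le hβ hP hPd hPγ hE hS hs J _) v ?_ hA0
  · rw [card_pattern hE hSE, hJ, hS]
  · refine ⟨fun j => congrFun hY j, mem_pattern_of_ne_zero hv fun j hj i => ?_, hl⟩
    by_contra hi
    exact hj (hJ₀J (Finset.mem_filter.2 ⟨Finset.mem_univ j, i, hi⟩))

end

theorem exists_field_card_factorial {n r : ℕ} (hr : 2 ≤ r) (hrn : r < n) :
    ∃ (F : Type) (_ : Field F) (_ : Fintype F) (_ : CharP F 2),
      n * r.factorial + r.choose 2 ≤ Fintype.card F ∧ Fintype.card F ≤ 3 * (n * r.factorial) := by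
  have hf : r ≤ r.factorial := Nat.self_le_factorial r
  have h1 : 2 * r.choose 2 ≤ n * r.factorial := by
    have h2 : 2 * r.choose 2 ≤ r * r := by
      rw [Nat.choose_two_right]
      exact (Nat.mul_div_le _ _).trans (Nat.mul_le_mul_left r (Nat.sub_le r 1))
    exact h2.trans (Nat.mul_le_mul hrn.le hf)
  have h2 : 3 * 2 ≤ n * r.factorial := Nat.mul_le_mul (by omega) (hr.trans hf)
  obtain ⟨F, i1, i2, i3, hq1, hq2⟩ :=
    exists_field_card (show 2 ≤ n * r.factorial + r.choose 2 by omega)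
  exact ⟨F, i1, i2, i3, hq1, by omega⟩

/-- For a single global parity the first tier suffices: no pattern is left for the second. -/
theorem hasScheme_one {μ n r b : ℕ} (hμ : 2 ≤ μ) (hμb : μ < b) (hb : b ≤ r) (hrn : r < n) :
    HasScheme μ n r 1 b (2 * n * b * (2 * n * μ) ^ (1 * (r + 1) - 1)) := by
  classical
  obtain ⟨F, _, _, _, hq1, hq2⟩ := exists_field_card_factorial (by omega) hrn
  obtain ⟨β, γ, P, hβ, hP, hPd, hPγ⟩ := exists_fibre_nodes (n := n) (by omega) (by omega) hb hq1
  have hrf : r ≤ r.factorial := Nat.self_le_factorial r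
  obtain ⟨z⟩ : Nonempty (Fin μ ↪ F) := Function.Embedding.nonempty_of_card_le (by
    rw [Fintype.card_fin]
    have : 1 * r.factorial ≤ n * r.factorial := Nat.mul_le_mul_right _ (by omega)
    omega)
  refine ⟨F, inferInstance, inferInstance, inferInstance, 1 + 0, β, _, by norm_num, ?_, hβ,
    admissible_append hβ hP hPd hPγ (by norm_num) (by omega) z.injective (A := fun _ => Fin.elim0)
      fun T D _ hfr v hv _ => ?_⟩
  · rw [add_zero, pow_one, one_mul, Nat.add_sub_cancel]
    have h1 : r.factorial ≤ (2 * n * μ) ^ r :=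
      (Nat.factorial_le_pow r).trans (Nat.pow_le_pow_left (by nlinarith) r)
    calc Fintype.card F ≤ 3 * (n * r.factorial) := hq2
      _ ≤ (2 * b) * (n * (2 * n * μ) ^ r) := by gcongr; omega
      _ = _ := by ring
  · have : patternSpace r β (groupOrthogonal μ γ) T D = ⊥ :=
      Submodule.finrank_eq_zero.1 (Nat.le_zero.1 hfr)
    rw [this] at hv
    simpa using hv

/-- Both tiers, over a field of size about `n * r !`. -/
theorem hasScheme_of_choose_mul_factorial_le {μ n r s b W : ℕ} (hs : 2 ≤ s) (hsμ : s ≤ μ)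
    (hμb : μ < b) (hb : b ≤ r) (hrn : r < n) (hW : W = s / 2 * r + s) (hWN : W ≤ μ * n)
    (h : (μ * n - 1).choose (W - 1) * b ^ W * (3 * (n * r.factorial)) ^ (2 * s - 1)
      ≤ 2 * n * b * (2 * n * μ) ^ (s * (r + 1) - 1)) :
    HasScheme μ n r s b (2 * n * b * (2 * n * μ) ^ (s * (r + 1) - 1)) := by
  classical
  obtain ⟨F, _, _, _, hq1, hq2⟩ := exists_field_card_factorial (by omega) hrn
  obtain ⟨β, γ, P, hβ, hP, hPd, hPγ⟩ := exists_fibre_nodes (n := n) (by omega) (by omega) hb hq1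
  have hrf : r ≤ r.factorial := Nat.self_le_factorial r
  obtain ⟨z⟩ : Nonempty (Fin μ ↪ F) := Function.Embedding.nonempty_of_card_le (by
    rw [Fintype.card_fin]
    have : 1 * r.factorial ≤ n * r.factorial := Nat.mul_le_mul_right _ (by omega)
    omega)
  set q := Fintype.card F
  have hq : 1 < q := Fintype.one_lt_card
  have hcnt : (μ * n - 1).choose (W - 1) * b ^ W * q ^ (s - 1 - 1) ≠ 0 := by
    have := Nat.choose_pos (show W - 1 ≤ μ * n - 1 by omega)
    have : 0 < b := by omega
    positivity
  obtain ⟨m, -, hm, hmle⟩ := exists_lt_pow_le_mul hq hcnt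
  obtain ⟨A, hA⟩ := exists_coeffs_of_patterns r β (groupOrthogonal μ γ) (by omega) (by omega) hm
  refine ⟨F, inferInstance, inferInstance, inferInstance, s + m, β, _, by omega, ?_, hβ,
    admissible_append hβ hP hPd hPγ (by omega) (by omega) z.injective
      fun T D hT => hA T D (hT.trans hW.symm)⟩
  obtain ⟨s', rfl⟩ : ∃ s', s = s' + 2 := ⟨s - 2, by omega⟩
  rw [show s' + 2 - 1 - 1 = s' by omega] at hmle
  refine le_trans ?_ h
  calc q ^ (s' + 2 + m) = q ^ (s' + 2) * q ^ m := pow_add _ _ _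
    _ ≤ q ^ (s' + 2) * ((μ * n - 1).choose (W - 1) * b ^ W * q ^ s' * q) :=
        Nat.mul_le_mul_left _ hmle
    _ = (μ * n - 1).choose (W - 1) * b ^ W * q ^ (2 * (s' + 2) - 1) := by
        rw [show 2 * (s' + 2) - 1 = (s' + 2) + s' + 1 by omega]; ring
    _ ≤ _ := by gcongr

/-! ### Elementary estimates -/

theorem pow_self_le_three_pow_mul_factorial (k : ℕ) : k ^ k ≤ 3 ^ k * k.factorial := by
  have h1 := Real.pow_div_factorial_le_exp (k : ℝ) (Nat.cast_nonneg k) k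
  rw [div_le_iff₀ (by positivity)] at h1
  have h2 : Real.exp (k : ℝ) ≤ 3 ^ k := by
    rw [← mul_one (k : ℝ), Real.exp_nat_mul]
    exact pow_le_pow_left₀ (Real.exp_pos 1).le (by linarith [Real.exp_one_lt_d9]) k
  have h3 : (k : ℝ) ^ k ≤ 3 ^ k * k.factorial :=
    h1.trans (mul_le_mul_of_nonneg_right h2 (by positivity))
  exact_mod_cast h3

theorem succ_pow_self_le_three_mul {k : ℕ} (hk : 0 < k) : (k + 1) ^ k ≤ 3 * k ^ k := by
  have hk' : (0 : ℝ) < k := by exact_mod_cast hk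
  have h1 : (1 + (k : ℝ)⁻¹) ^ k ≤ 3 := by
    calc (1 + (k : ℝ)⁻¹) ^ k ≤ Real.exp ((k : ℝ)⁻¹) ^ k := by
          refine pow_le_pow_left₀ (by positivity) ?_ k
          rw [add_comm]
          exact Real.add_one_le_exp _
      _ = Real.exp 1 := by rw [← Real.exp_nat_mul, mul_inv_cancel₀ hk'.ne']
      _ ≤ 3 := by linarith [Real.exp_one_lt_d9]
  have h2 : ((k : ℝ) + 1) ^ k ≤ 3 * (k : ℝ) ^ k := by
    calc ((k : ℝ) + 1) ^ k = (1 + (k : ℝ)⁻¹) ^ k * (k : ℝ) ^ k := by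
          rw [← mul_pow, add_mul, inv_mul_cancel₀ hk'.ne', one_mul]
      _ ≤ _ := mul_le_mul_of_nonneg_right h1 (by positivity)
  exact_mod_cast h2

theorem choose_sub_one_mul_factorial_le (N k : ℕ) : (N - 1).choose k * k.factorial ≤ N ^ k := by
  rw [mul_comm, ← Nat.descFactorial_eq_factorial_mul_choose]
  exact (Nat.descFactorial_le_pow _ _).trans (Nat.pow_le_pow_left (Nat.sub_le N 1) k)

/-! ### The case of more global parities than groups -/

/-- The case `s = μ + 1`, with `r` in place of the number of digits. -/
theorem pow_mul_pow_le_of_succ {μ n r : ℕ} (hμ : 2 ≤ μ) (hμr : μ < r) (hrn : r ≤ n) :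
    r ^ (μ * (r + 1) + 1) * (2 * (r * n)) ^ μ
      ≤ 2 ^ ((μ + 1) * (r + 1) - 1) * (μ * (r + 1)).factorial * (μ * n) ^ r := by
  set k := μ * (r + 1) with hk
  have hk4 : 4 * μ ≤ k := by rw [hk, mul_comm]; exact Nat.mul_le_mul_left μ (by omega)
  -- Stirling with `3` in place of `e`
  have h1 : r ^ k * 2 ^ μ ≤ 2 ^ k * k.factorial := by
    have h43 : 3 ^ k * 2 ^ μ ≤ 4 ^ k := by
      obtain ⟨l, hl⟩ := Nat.exists_eq_add_of_le hk4
      rw [hl, pow_add, pow_add]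
      calc 3 ^ (4 * μ) * 3 ^ l * 2 ^ μ = (3 ^ 4 * 2) ^ μ * 3 ^ l := by
            rw [pow_mul, mul_pow]; ring
        _ ≤ (4 ^ 4) ^ μ * 4 ^ l := by gcongr <;> norm_num
        _ = _ := by rw [pow_mul]
    refine Nat.le_of_mul_le_mul_left ?_ (pow_pos (show 0 < 3 by norm_num) k)
    calc 3 ^ k * (r ^ k * 2 ^ μ) = (3 ^ k * 2 ^ μ) * r ^ k := by ring
      _ ≤ 4 ^ k * r ^ k := Nat.mul_le_mul_right _ h43
      _ = (4 * r) ^ k := by rw [mul_pow]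
      _ ≤ (2 * k) ^ k := Nat.pow_le_pow_left (by rw [hk]; nlinarith) k
      _ = 2 ^ k * k ^ k := mul_pow _ _ _
      _ ≤ 2 ^ k * (3 ^ k * k.factorial) :=
          Nat.mul_le_mul_left _ (pow_self_le_three_pow_mul_factorial k)
      _ = _ := by ring
  have h2 : r ^ (2 * μ + 1) ≤ (2 * μ * r) ^ r := by
    by_cases h : 2 * μ + 1 ≤ r
    · exact (Nat.pow_le_pow_right (by omega) h).trans
        (Nat.pow_le_pow_left (Nat.le_mul_of_pos_left r (by omega)) r)
    · calc r ^ (2 * μ + 1) ≤ r ^ (2 * r) := Nat.pow_le_pow_right (by omega) (by omega)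
        _ = (r * r) ^ r := by rw [pow_mul, pow_two]
        _ ≤ _ := Nat.pow_le_pow_left (Nat.mul_le_mul_right r (by omega)) r
  obtain ⟨t, ht⟩ := Nat.exists_eq_add_of_le hμr.le
  have h3 : (μ + 1) * (r + 1) - 1 = k + r := by
    rw [hk, add_mul, one_mul, ← add_assoc, Nat.add_sub_cancel]
  have h4 : r ^ μ * n ^ μ * r ^ r ≤ r ^ (2 * μ) * n ^ r := by
    calc r ^ μ * n ^ μ * r ^ r = r ^ (2 * μ) * (n ^ μ * r ^ t) := by
          conv_lhs => rw [show r ^ r = r ^ (μ + t) by rw [← ht]]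
          ring
      _ ≤ r ^ (2 * μ) * (n ^ μ * n ^ t) := by gcongr
      _ = r ^ (2 * μ) * n ^ r := by rw [← pow_add, ← ht]
  rw [h3]
  have hr0 : 0 < r := by omega
  refine Nat.le_of_mul_le_mul_left ?_ (pow_pos hr0 r)
  calc r ^ r * (r ^ (k + 1) * (2 * (r * n)) ^ μ)
      = (r ^ k * 2 ^ μ) * r * (r ^ μ * n ^ μ * r ^ r) := by rw [mul_pow, mul_pow]; ring
    _ ≤ (2 ^ k * k.factorial) * r * (r ^ (2 * μ) * n ^ r) := by gcongr
    _ = (2 ^ k * k.factorial) * n ^ r * r ^ (2 * μ + 1) := by ring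
    _ ≤ (2 ^ k * k.factorial) * n ^ r * (2 * μ * r) ^ r := Nat.mul_le_mul_left _ h2
    _ = _ := by simp only [mul_pow, pow_add]; ring

/-- The estimate for the greedy choice with `s = μ + t + 1`; both sides grow by a fixed factor with
`t`. -/
theorem pow_mul_pow_le_of_lt {μ n r : ℕ} (hμ : 2 ≤ μ) (hμr : μ < r) (hrn : r ≤ n) (t : ℕ) :
    r ^ (μ * (r + 1) + t + 1) * (2 * (r * n)) ^ (μ + t)
      ≤ 2 ^ ((μ + t + 1) * (r + 1) - 1) * (μ * (r + 1) + t).factorial *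
        (μ * n) ^ ((t + 1) * r) := by
  induction t with
  | zero => simpa using pow_mul_pow_le_of_succ hμ hμr hrn
  | succ t ih =>
    have h1 : (μ + (t + 1) + 1) * (r + 1) - 1 = ((μ + t + 1) * (r + 1) - 1) + (r + 1) := by
      have h2 : 1 ≤ (μ + t + 1) * (r + 1) := Nat.mul_pos (by omega) (by omega)
      have h3 : (μ + (t + 1) + 1) * (r + 1) = (μ + t + 1) * (r + 1) + (r + 1) := by ring
      omega
    have h2 : r * (2 * (r * n)) ≤ 2 ^ (r + 1) * (μ * n) ^ r := by
      calc r * (2 * (r * n)) ≤ n * (2 * (n * n)) := by gcongr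
        _ = 2 * n ^ 3 := by ring
        _ ≤ 2 ^ (r + 1) * (μ * n) ^ r := by
          refine Nat.mul_le_mul ?_ ?_
          · rw [pow_succ]
            exact Nat.le_mul_of_pos_left 2 (by positivity)
          exact (Nat.pow_le_pow_left (Nat.le_mul_of_pos_left n (by omega)) 3).trans
            (Nat.pow_le_pow_right (Nat.mul_pos (by omega) (by omega)) (by omega))
    rw [h1, ← add_assoc (μ * (r + 1)), Nat.factorial_succ]
    calc r ^ (μ * (r + 1) + t + 1 + 1) * (2 * (r * n)) ^ (μ + (t + 1))
        = (r ^ (μ * (r + 1) + t + 1) * (2 * (r * n)) ^ (μ + t)) * (r * (2 * (r * n))) := by ring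
      _ ≤ (2 ^ ((μ + t + 1) * (r + 1) - 1) * (μ * (r + 1) + t).factorial * (μ * n) ^ ((t + 1) * r))
          * (2 ^ (r + 1) * (μ * n) ^ r) := Nat.mul_le_mul ih h2
      _ ≤ (2 ^ ((μ + t + 1) * (r + 1) - 1) * (μ * (r + 1) + t).factorial * (μ * n) ^ ((t + 1) * r))
          * (2 ^ (r + 1) * (μ * n) ^ r) * (μ * (r + 1) + t + 1) :=
          Nat.le_mul_of_pos_right _ (by omega)
      _ = _ := by rw [add_mul (t + 1) 1 r, one_mul, pow_add _ ((t + 1) * r) r,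
                    pow_add 2 _ (r + 1)]; ring

theorem hasScheme_of_lt {μ n r s b : ℕ} (hμ : 2 ≤ μ) (hμb : μ < b) (hb : b ≤ r) (hrn : r < n)
    (hsμ : μ < s) (hsn : (n - r) + s ≤ (n - r) * μ) :
    HasScheme μ n r s b (2 * n * b * (2 * n * μ) ^ (s * (r + 1) - 1)) := by
  have hN : (n - r) * μ + μ * r = μ * n := by
    rw [mul_comm (n - r), ← mul_add, Nat.sub_add_cancel hrn.le]
  refine hasScheme_of_choose_mul_le (W := μ * r + s) (by omega) (by omega) (by omega)
    (by rw [min_eq_right hsμ.le]) (by omega) ?_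
  obtain ⟨t, rfl⟩ : ∃ t, s = μ + t + 1 := ⟨s - μ - 1, by omega⟩
  set k := μ * (r + 1) + t with hk
  have hW : μ * r + (μ + t + 1) = k + 1 := by rw [hk]; ring
  have hexp : (μ + t + 1) * (r + 1) - 1 = k + (t + 1) * r := by
    rw [Nat.sub_eq_iff_eq_add (Nat.mul_pos (by omega) (by omega)), hk]; ring
  rw [hW, Nat.add_sub_cancel, Nat.add_sub_cancel]
  have h := pow_mul_pow_le_of_lt hμ (lt_of_lt_of_le hμb hb) hrn.le t
  rw [← hk] at h
  refine Nat.le_of_mul_le_mul_left ?_ (Nat.factorial_pos k)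
  calc k.factorial * ((μ * n - 1).choose k * b ^ (k + 1) * (2 * (b * n)) ^ (μ + t))
      = ((μ * n - 1).choose k * k.factorial) * (b ^ (k + 1) * (2 * (b * n)) ^ (μ + t)) := by ring
    _ ≤ (μ * n) ^ k * (r ^ (k + 1) * (2 * (r * n)) ^ (μ + t)) := by
        gcongr
        exact choose_sub_one_mul_factorial_le _ _
    _ ≤ (μ * n) ^ k * (2 ^ ((μ + t + 1) * (r + 1) - 1) * k.factorial * (μ * n) ^ ((t + 1) * r)) :=
        Nat.mul_le_mul_left _ h
    _ = _ := by
        rw [hexp, show 2 * n * μ = 2 * (μ * n) by ring, mul_pow 2 (μ * n),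
          pow_add (μ * n) k]
        ring

/-! ### The case of at most as many global parities as groups -/

/-- The estimate behind the one-tier family; it holds for `n` small in comparison with `r`. -/
def OneTierBound (n r s : ℕ) : Prop :=
  (2 * (r * n)) ^ (s - 1) * r ^ (s * (r + 1)) ≤ 2 ^ (s * (r + 1) - 1) * (s * (r + 1) - 1).factorial

/-- The estimate behind the two-tier family; it holds for `n` large in comparison with `r`. -/
def TwoTierBound (n r s : ℕ) : Prop :=
  r ^ (s / 2 * r + s - 1) * (3 * r.factorial) ^ (2 * s - 1) * n ^ (2 * s - 2)
    ≤ 2 ^ (s * (r + 1)) * (s * n) ^ ((s - s / 2) * r) * (s / 2 * r + s - 1).factorial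

instance (n r s : ℕ) : Decidable (OneTierBound n r s) := inferInstanceAs (Decidable (_ ≤ _))

instance (n r s : ℕ) : Decidable (TwoTierBound n r s) := inferInstanceAs (Decidable (_ ≤ _))

theorem OneTierBound.hasScheme {μ n r s b : ℕ} (h : OneTierBound n r s) (hs : 0 < s) (hsμ : s ≤ μ)
    (hb0 : 0 < b) (hb : b ≤ r) (hrn : r < n) (hsn : (n - r) + s ≤ (n - r) * μ) :
    HasScheme μ n r s b (2 * n * b * (2 * n * μ) ^ (s * (r + 1) - 1)) := by
  have hN : (n - r) * μ + μ * r = μ * n := by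
    rw [mul_comm (n - r), ← mul_add, Nat.sub_add_cancel hrn.le]
  have hsr : s * r ≤ μ * r := Nat.mul_le_mul_right r hsμ
  have hW1 : s * (r + 1) = s * r + s := by ring
  refine hasScheme_of_choose_mul_le (W := s * (r + 1)) hs hb0 (by omega)
    (by rw [min_eq_left hsμ, hW1]) (by omega) ?_
  set W := s * (r + 1)
  refine Nat.le_of_mul_le_mul_left ?_ (Nat.factorial_pos (W - 1))
  calc (W - 1).factorial * ((μ * n - 1).choose (W - 1) * b ^ W * (2 * (b * n)) ^ (s - 1))
      = ((μ * n - 1).choose (W - 1) * (W - 1).factorial) * ((2 * (b * n)) ^ (s - 1) * b ^ W) := by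
        ring
    _ ≤ (μ * n) ^ (W - 1) * ((2 * (r * n)) ^ (s - 1) * r ^ W) := by
        gcongr
        exact choose_sub_one_mul_factorial_le _ _
    _ ≤ (μ * n) ^ (W - 1) * (2 ^ (W - 1) * (W - 1).factorial) := Nat.mul_le_mul_left _ h
    _ = _ := by rw [show 2 * n * μ = 2 * (μ * n) by ring, mul_pow 2 (μ * n)]; ring

theorem TwoTierBound.hasScheme {μ n r s b : ℕ} (h : TwoTierBound n r s) (hs : 2 ≤ s) (hsμ : s ≤ μ)
    (hμb : μ < b) (hb : b ≤ r) (hrn : r < n) (hsn : (n - r) + s ≤ (n - r) * μ) :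
    HasScheme μ n r s b (2 * n * b * (2 * n * μ) ^ (s * (r + 1) - 1)) := by
  have hN : (n - r) * μ + μ * r = μ * n := by
    rw [mul_comm (n - r), ← mul_add, Nat.sub_add_cancel hrn.le]
  have hsr : s / 2 * r ≤ μ * r := Nat.mul_le_mul_right r (by omega)
  refine hasScheme_of_choose_mul_factorial_le (W := s / 2 * r + s) hs hsμ hμb hb hrn rfl
    (by omega) ?_
  set k := s / 2 * r + s - 1 with hk
  have hk1 : s / 2 * r + s = k + 1 := by omega
  have hexp : k + (s - s / 2) * r = s * (r + 1) - 1 := by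
    have h1 : s / 2 * r + (s - s / 2) * r = s * r := by
      rw [← add_mul]; congr 1; omega
    have h2 : s * (r + 1) = s * r + s := by ring
    omega
  have hW : s * (r + 1) = (s * (r + 1) - 1) + 1 := by
    have : 0 < s * (r + 1) := Nat.mul_pos (by omega) (by omega)
    omega
  rw [hk1]
  refine Nat.le_of_mul_le_mul_left ?_ (Nat.factorial_pos k)
  calc k.factorial * ((μ * n - 1).choose k * b ^ (k + 1) * (3 * (n * r.factorial)) ^ (2 * s - 1))
      = ((μ * n - 1).choose k * k.factorial) * (b * b ^ k) *
          ((3 * r.factorial) ^ (2 * s - 1) * n ^ (2 * s - 1)) := by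
        rw [show 3 * (n * r.factorial) = 3 * r.factorial * n by ring, mul_pow _ n]; ring
    _ ≤ (μ * n) ^ k * (b * r ^ k) * ((3 * r.factorial) ^ (2 * s - 1) * n ^ (2 * s - 1)) := by
        gcongr
        exact choose_sub_one_mul_factorial_le _ _
    _ = b * n * (μ * n) ^ k * (r ^ k * (3 * r.factorial) ^ (2 * s - 1) * n ^ (2 * s - 2)) := by
        rw [show 2 * s - 1 = (2 * s - 2) + 1 by omega, pow_succ n]; ring
    _ ≤ b * n * (μ * n) ^ k * (2 ^ (s * (r + 1)) * (s * n) ^ ((s - s / 2) * r) * k.factorial) :=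
        Nat.mul_le_mul_left _ h
    _ ≤ b * n * (μ * n) ^ k * (2 ^ (s * (r + 1)) * (μ * n) ^ ((s - s / 2) * r) * k.factorial) := by
        gcongr
    _ = b * n * 2 ^ (s * (r + 1)) * (μ * n) ^ (s * (r + 1) - 1) * k.factorial := by
        rw [← hexp, pow_add]; ring
    _ = _ := by
        rw [show 2 * n * μ = 2 * (μ * n) by ring, mul_pow 2 (μ * n)]
        conv_lhs => rw [hW, pow_succ 2]
        simp only [Nat.add_sub_cancel]
        ring

theorem OneTierBound.mono {n n' r s : ℕ} (h : OneTierBound n r s) (hn : n' ≤ n) :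
    OneTierBound n' r s :=
  le_trans (by gcongr) h

theorem TwoTierBound.mono {n n' r s : ℕ} (h : TwoTierBound n r s) (hn : n ≤ n') (hn0 : 0 < n)
    (he : 2 * s - 2 ≤ (s - s / 2) * r) : TwoTierBound n' r s := by
  obtain ⟨t, ht⟩ := Nat.exists_eq_add_of_le he
  unfold TwoTierBound at h ⊢
  rw [ht] at h ⊢
  set p := 2 * s - 2
  set X := r ^ (s / 2 * r + s - 1) * (3 * r.factorial) ^ (2 * s - 1)
  set k := s / 2 * r + s - 1
  have h1 : X ≤ 2 ^ (s * (r + 1)) * s ^ (p + t) * n ^ t * k.factorial := by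
    refine Nat.le_of_mul_le_mul_right ?_ (pow_pos hn0 p)
    refine h.trans (le_of_eq ?_)
    rw [mul_pow, pow_add n]; ring
  calc X * n' ^ p ≤ (2 ^ (s * (r + 1)) * s ^ (p + t) * n ^ t * k.factorial) * n' ^ p := by gcongr
    _ ≤ (2 ^ (s * (r + 1)) * s ^ (p + t) * n' ^ t * k.factorial) * n' ^ p := by gcongr
    _ = _ := by rw [mul_pow, pow_add n']; ring

/-- For `r ≤ 18` the two ranges of `n` meet at `r ^ 2`. -/
theorem tierBounds_of_le : ∀ r ∈ Finset.Icc 3 18, ∀ s ∈ Finset.Icc 2 (r - 1),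
    OneTierBound (r ^ 2) r s ∧ TwoTierBound (r ^ 2 + 1) r s ∧ 2 * s - 2 ≤ (s - s / 2) * r := by
  decide +kernel

/-- The estimate for `s = 2` and `n = r ^ 4`, which implies the one for larger `s`. -/
theorem oneTierBound_two {r : ℕ} (hr : 19 ≤ r) :
    2 * r ^ (2 * r + 7) ≤ 2 ^ (2 * r + 1) * (2 * r + 1).factorial := by
  induction r, hr using Nat.le_induction with
  | base => decide +kernel
  | succ r hr ih =>
    have h1 : (r + 1) ^ (2 * r + 7) ≤ 16 * r ^ (2 * r + 7) := by
      have h2 : (r + 1) ^ 7 * 9 ≤ 16 * r ^ 7 := by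
        refine Nat.le_of_mul_le_mul_left ?_ (show 0 < 19 ^ 7 by norm_num)
        calc 19 ^ 7 * ((r + 1) ^ 7 * 9) = (19 * (r + 1)) ^ 7 * 9 := by ring
          _ ≤ (20 * r) ^ 7 * 9 :=
              Nat.mul_le_mul_right 9 (Nat.pow_le_pow_left (by omega) 7)
          _ = (20 ^ 7 * 9) * r ^ 7 := by ring
          _ ≤ (19 ^ 7 * 16) * r ^ 7 := Nat.mul_le_mul_right _ (by norm_num)
          _ = _ := by ring
      calc (r + 1) ^ (2 * r + 7) = ((r + 1) ^ r) ^ 2 * (r + 1) ^ 7 := by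
            rw [← pow_mul, ← pow_add, mul_comm r 2]
        _ ≤ (3 * r ^ r) ^ 2 * (r + 1) ^ 7 := by
            gcongr
            exact succ_pow_self_le_three_mul (by omega)
        _ = (r ^ r) ^ 2 * ((r + 1) ^ 7 * 9) := by ring
        _ ≤ (r ^ r) ^ 2 * (16 * r ^ 7) := Nat.mul_le_mul_left _ h2
        _ = _ := by rw [← pow_mul, pow_add, mul_comm r 2]; ring
    have h3 : (2 * (r + 1) + 1).factorial
        = (2 * r + 3) * ((2 * r + 2) * (2 * r + 1).factorial) := by
      rw [show 2 * (r + 1) + 1 = 2 * r + 1 + 1 + 1 by ring, Nat.factorial_succ, Nat.factorial_succ]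
    calc 2 * (r + 1) ^ (2 * (r + 1) + 7) = 2 * (r + 1) ^ 2 * (r + 1) ^ (2 * r + 7) := by ring
      _ ≤ 2 * (r + 1) ^ 2 * (16 * r ^ (2 * r + 7)) := Nat.mul_le_mul_left _ h1
      _ = 16 * (r + 1) ^ 2 * (2 * r ^ (2 * r + 7)) := by ring
      _ ≤ 16 * (r + 1) ^ 2 * (2 ^ (2 * r + 1) * (2 * r + 1).factorial) := Nat.mul_le_mul_left _ ih
      _ ≤ 4 * ((2 * r + 3) * (2 * r + 2)) * (2 ^ (2 * r + 1) * (2 * r + 1).factorial) := by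
          refine Nat.mul_le_mul_right _ ?_
          nlinarith
      _ = _ := by rw [h3]; ring

theorem oneTierBound_of_le {r s : ℕ} (hr : 19 ≤ r) (hs : 2 ≤ s) : OneTierBound (r ^ 4) r s := by
  have h4 : 2 * (r * r ^ 4) ≤ 4 ^ (r + 1) := by
    induction r, hr using Nat.le_induction with
    | base => norm_num
    | succ r hr ih =>
      calc 2 * ((r + 1) * (r + 1) ^ 4) = 2 * (r + 1) ^ 5 := by ring
        _ ≤ 4 * (2 * (r * r ^ 4)) := by
          have h1 : 19 * (r + 1) ≤ 20 * r := by omega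
          have h2 := Nat.pow_le_pow_left h1 5
          rw [mul_pow, mul_pow] at h2
          have h3 : r * r ^ 4 = r ^ 5 := by ring
          rw [h3]
          omega
        _ ≤ 4 * 4 ^ (r + 1) := Nat.mul_le_mul_left 4 ih
        _ = _ := by ring
  induction s, hs using Nat.le_induction with
  | base =>
    have h := oneTierBound_two hr
    unfold OneTierBound
    rw [show 2 * (r + 1) - 1 = 2 * r + 1 by omega]
    refine le_trans (le_of_eq ?_) h
    ring
  | succ s hs ih =>
    unfold OneTierBound at ih ⊢
    have hW : 0 < s * (r + 1) := Nat.mul_pos (by omega) (by omega)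
    obtain ⟨w, hw⟩ : ∃ w, s * (r + 1) = w + 1 := ⟨s * (r + 1) - 1, by omega⟩
    rw [show (s + 1) * (r + 1) = w + 1 + (r + 1) by rw [← hw]; ring,
      show w + 1 + (r + 1) - 1 = w + (r + 1) by omega]
    rw [hw, Nat.add_sub_cancel] at ih
    obtain ⟨s', rfl⟩ : ∃ s', s = s' + 1 := ⟨s - 1, by omega⟩
    rw [Nat.add_sub_cancel] at ih ⊢
    have hrw : 2 * r ≤ w + 1 := by rw [← hw]; nlinarith
    calc (2 * (r * r ^ 4)) ^ (s' + 1) * r ^ (w + 1 + (r + 1))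
        = ((2 * (r * r ^ 4)) ^ s' * r ^ (w + 1)) * (2 * (r * r ^ 4) * r ^ (r + 1)) := by ring
      _ ≤ (2 ^ w * w.factorial) * (4 ^ (r + 1) * r ^ (r + 1)) := by gcongr
      _ = 2 ^ w * 2 ^ (r + 1) * (w.factorial * (2 * r) ^ (r + 1)) := by
          rw [mul_pow, show (4 : ℕ) = 2 * 2 by norm_num, mul_pow]; ring
      _ ≤ 2 ^ w * 2 ^ (r + 1) * (w.factorial * (w + 1) ^ (r + 1)) := by gcongr
      _ ≤ 2 ^ w * 2 ^ (r + 1) * (w + (r + 1)).factorial :=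
          Nat.mul_le_mul_left _ Nat.factorial_mul_pow_le_factorial
      _ = _ := by rw [← pow_add]

theorem three_mul_factorial_le {r : ℕ} (hr : 19 ≤ r) : 3 * r.factorial ≤ r ^ (r - 4) := by
  induction r, hr using Nat.le_induction with
  | base => decide +kernel
  | succ r hr ih =>
    rw [Nat.factorial_succ, show r + 1 - 4 = (r - 4) + 1 by omega, pow_succ]
    calc 3 * ((r + 1) * r.factorial) = (3 * r.factorial) * (r + 1) := by ring
      _ ≤ (r + 1) ^ (r - 4) * (r + 1) :=
          Nat.mul_le_mul_right _ (ih.trans (Nat.pow_le_pow_left (Nat.le_succ r) _))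

theorem twoTierBound_of_le {n r s : ℕ} (hr : 19 ≤ r) (hs : 2 ≤ s) (hn : r ^ 4 ≤ n) :
    TwoTierBound n r s := by
  set h := s / 2 with hh
  have hh1 : 1 ≤ h := by omega
  set k := h * r + s - 1 with hk
  have hrk : r ≤ k := by
    have : 1 * r ≤ h * r := Nat.mul_le_mul_right r hh1
    omega
  have h1 : r ^ k ≤ 2 ^ (s * (r + 1)) * k.factorial := by
    have h2 : 3 ^ k ≤ 2 ^ (s * (r + 1)) := by
      rw [← Nat.pow_le_pow_iff_left (n := 2) (by norm_num)]
      have h3 : k * 2 ≤ (r + 2) * s := by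
        have h4 : h * 2 * r ≤ s * r := Nat.mul_le_mul_right r (by omega)
        have h5 : (r + 2) * s = s * r + 2 * s := by ring
        have h6 : h * 2 * r = h * r * 2 := by ring
        omega
      have h4 : 3 ^ (r + 2) ≤ 4 ^ (r + 1) := by
        obtain ⟨t, rfl⟩ := Nat.exists_eq_add_of_le hr
        calc 3 ^ (19 + t + 2) = 3 ^ 21 * 3 ^ t := by ring
          _ ≤ 4 ^ 20 * 4 ^ t :=
              Nat.mul_le_mul (by norm_num) (Nat.pow_le_pow_left (by norm_num) t)
          _ = _ := by ring
      calc (3 ^ k) ^ 2 = 3 ^ (k * 2) := by rw [pow_mul]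
        _ ≤ 3 ^ ((r + 2) * s) := Nat.pow_le_pow_right (by norm_num) h3
        _ = (3 ^ (r + 2)) ^ s := pow_mul _ _ _
        _ ≤ (4 ^ (r + 1)) ^ s := Nat.pow_le_pow_left h4 s
        _ = _ := by rw [show (4 : ℕ) = 2 ^ 2 by norm_num, ← pow_mul, ← pow_mul, ← pow_mul]; ring_nf
    calc r ^ k ≤ k ^ k := Nat.pow_le_pow_left hrk k
      _ ≤ 3 ^ k * k.factorial := pow_self_le_three_pow_mul_factorial k
      _ ≤ _ := Nat.mul_le_mul_right _ h2
  have h2 : (3 * r.factorial) ^ (2 * s - 1) * n ^ (2 * s - 2) ≤ n ^ ((s - h) * r) := by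
    have hf : 0 < 3 * r.factorial := by positivity
    have hn0 : 0 < n := lt_of_lt_of_le (by positivity) hn
    have h3 : (3 * r.factorial) ^ 4 * n ^ 4 ≤ n ^ r := by
      calc (3 * r.factorial) ^ 4 * n ^ 4 ≤ (r ^ (r - 4)) ^ 4 * n ^ 4 := by
            gcongr
            exact three_mul_factorial_le hr
        _ = (r ^ 4) ^ (r - 4) * n ^ 4 := by rw [← pow_mul, ← pow_mul, mul_comm (r - 4)]
        _ ≤ n ^ (r - 4) * n ^ 4 := by gcongr
        _ = n ^ r := by rw [← pow_add, Nat.sub_add_cancel (by omega)]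
    -- squaring allows to use `s ≤ 2 * (s - s / 2)`, which covers both parities of `s`
    rw [← Nat.pow_le_pow_iff_left (n := 2) (by norm_num)]
    calc ((3 * r.factorial) ^ (2 * s - 1) * n ^ (2 * s - 2)) ^ 2
        ≤ ((3 * r.factorial) ^ (2 * s) * n ^ (2 * s)) ^ 2 := by
          refine Nat.pow_le_pow_left (Nat.mul_le_mul ?_ ?_) 2
          · exact Nat.pow_le_pow_right hf (Nat.sub_le _ 1)
          · exact Nat.pow_le_pow_right hn0 (Nat.sub_le _ 2)
      _ = ((3 * r.factorial) ^ 4 * n ^ 4) ^ s := by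
          rw [← mul_pow, ← mul_pow, ← pow_mul, ← pow_mul]
          congr 1
          ring
      _ ≤ (n ^ r) ^ s := Nat.pow_le_pow_left h3 s
      _ = n ^ (s * r) := by rw [← pow_mul, mul_comm]
      _ ≤ n ^ ((s - h) * 2 * r) :=
          Nat.pow_le_pow_right hn0 (Nat.mul_le_mul_right r (by omega))
      _ = _ := by rw [← pow_mul]; ring_nf
  unfold TwoTierBound
  rw [← hh, ← hk]
  calc r ^ k * (3 * r.factorial) ^ (2 * s - 1) * n ^ (2 * s - 2)
      = r ^ k * ((3 * r.factorial) ^ (2 * s - 1) * n ^ (2 * s - 2)) := by ring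
    _ ≤ (2 ^ (s * (r + 1)) * k.factorial) * n ^ ((s - h) * r) := Nat.mul_le_mul h1 h2
    _ ≤ (2 ^ (s * (r + 1)) * k.factorial) * (s * n) ^ ((s - h) * r) := by
        gcongr
        exact Nat.le_mul_of_pos_left n (by omega)
    _ = _ := by ring

/-! ### Existence of the code -/

/-- There always is a family of the required size: for `b ≤ μ` powers of field elements, for `s > μ`
the greedy choice in one tier, and otherwise one tier or two tiers according to the size of `n` in
comparison with `r`. -/
theorem exists_hasScheme {μ n r s b : ℕ} (hμ : 2 ≤ μ) (hr : 0 < r) (hs : 0 < s) (hb0 : 0 < b)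
    (hb : b ≤ r) (hrn : r < n) (hsn : (n - r) + s ≤ (n - r) * μ) :
    HasScheme μ n r s b (2 * n * b * (2 * n * μ) ^ (s * (r + 1) - 1)) := by
  rcases le_or_gt b μ with hbμ | hμb
  · exact hasScheme_of_le hμ hr hs hb0 (by omega) hbμ
  rcases lt_or_ge μ s with hsμ | hsμ
  · exact hasScheme_of_lt hμ hμb hb hrn hsμ hsn
  rcases (show 1 = s ∨ 2 ≤ s by omega) with rfl | hs2
  · exact hasScheme_one hμ hμb hb hrn
  rcases le_or_gt r 18 with hr18 | hr18
  · obtain ⟨h1, h2, h3⟩ := tierBounds_of_le r (Finset.mem_Icc.2 ⟨by omega, hr18⟩) s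
      (Finset.mem_Icc.2 ⟨hs2, by omega⟩)
    rcases le_or_gt n (r ^ 2) with hn | hn
    · exact (h1.mono hn).hasScheme hs hsμ hb0 hb hrn hsn
    · exact (h2.mono hn (Nat.succ_pos _) h3).hasScheme hs2 hsμ hμb hb hrn hsn
  · rcases le_or_gt n (r ^ 4) with hn | hn
    · exact ((oneTierBound_of_le hr18 hs2).mono hn).hasScheme hs hsμ hb0 hb hrn hsn
    · exact (twoTierBound_of_le hr18 hs2 hn.le).hasScheme hs2 hsμ hμb hb hrn hsn

theorem mainTheorem4 (μ n r s d : ℕ) (hμ : 0 < μ) (hr : 0 < r) (hs : 0 < s) (hrn : r ≤ n)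
    (hsn : (n - r) + s ≤ (n - r) * μ) (hd : n - r ≤ d) (hdn : d < n) :
    ∃ q M : ℕ, IsPrimePow q ∧ 0 < M ∧ (d + 1 - (n - r)) * n ≤ q ∧
      q ^ M ≤ 2 * n * (d + 1 - (n - r)) * (2 * n * μ) ^ (s * (r + 1) - 1) ∧
      ∃ (F K : Type) (_ : Field F) (_ : Field K) (_ : Algebra F K),
        Nat.card F = q ∧ Nat.card K = q ^ M ∧
        ∃ (β : Fin n → Fin (d + 1 - (n - r)) → F) (α : Fin μ → Fin n → K),
          Function.Injective (Function.uncurry β) ∧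
          ArrayCode.IsLocallyMSRPMDS μ n r s 1 d ((d + 1 - (n - r)) ^ n)
            (pmdsCode r s q β α) := by
  have hrn' : r < n := by
    refine lt_of_le_of_ne hrn fun h => ?_
    simp only [h, Nat.sub_self, zero_mul] at hsn
    omega
  have hμ2 : 2 ≤ μ := by
    by_contra h
    obtain rfl : μ = 1 := by omega
    omega
  obtain ⟨F, _, _, _, M, β, A, hM, hbound, hβ, hA⟩ :=
    exists_hasScheme (b := d + 1 - (n - r)) hμ2 hr hs (by omega) (by omega) hrn' hsn
  exact exists_code_of_admissible F hμ hr hs hrn' hsn hd hdn hM hβ hA hbound
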